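/- **Setting.** Let $I\subseteq\mathbb R$ be an open interval and $\kappa:I\to\mathbb R$ continuous. For $t_0\in I$ let $c(\cdot,t_0)$ and $s(\cdot,t_0)$ be the solutions on $I$ of $\ddot u+\kappa u=0$ with $c(t_0,t_0)=\dot s(t_0,t_0)=1$ and $\dot c(t_0,t_0)=s(t_0,t_0)=0$ (dots are derivatives in the first argument). An Ermakov–Pinney solution is a function $\rho:I\to(0,\infty)$ with $\ddot\rho+\kappa\rho=\rho^{-3}$. If $u$ is a nonzero solution of $\ddot u+\kappa u=0$, let $\mathfrak m(u;t,t_0)$ be the number of zeros of $u$ in $(t_0,t]$ if $t\ge t_0$, and minus the number of zeros of $u$ in $(t,t_0]$ if $t<t_0$; put $$u^{\epsilon}(t,t_0):=e^{i\epsilon\pi\,\mathfrak m(u;t,t_0)}|u(t)|^{\epsilon},$$ and $s^{\epsilon}(t,t_0)$, $c^{\epsilon}(t,t_0)$ for $u=s(\cdot,t_0)$, $u=c(\cdot,t_0)$. On Schwartz functions let $(Q\psi)(q)=q\psi(q)$ and $(P\psi)(q)=-i\psi'(q)$. The operators $Q^2$, $QP+PQ$, $P^2+Q^2$ and $H(t)=\frac12(P^2+\kappa(t)Q^2)$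 denote the closures in $L^2(\mathbb R)$ of the corresponding operators on $\mathscr S(\mathbb R)$. More generally, for a Hilbert space $\mathscr H$ and a unitary $W:L^2(\mathbb R)\to\mathscr H$, consider the representation of the canonical commutation relations obtained by transporting these operators, and their domains, to $\mathscr H$ by $W$ (the Schrödinger representation is $W=\mathbf 1$). For an operator $A$, $\tau\mapsto e^{i\tau A}$ is the strongly continuous one-parameter unitary group with generator $A$. Put $$D(x)=e^{-\frac i2xQ^2},\quad S(y)=e^{\frac i2y(QP+PQ)},\quad T_\rho(t)=S(\log\rho(t))\,D(\dot\rho(t)/\rho(t)),\quad R_\rho(t,t_0)=\exp\Big(-\frac i2\int_{t_0}^t\frac{d\tau}{\rho^2(\tau)}\,(P^2+Q^2)\Big).$$ A unitary evolution for $H(t)$ is a family of unitary operators $U(t,t_0)$, $t,t_0\in I$, jointly strongly continuous, with $U(t,t)=\mathbf 1$ and $U(t_2,t_1)U(t_1,t_0)=U(t_2,t_0)$, such that for every $\psi\in W\mathscr S(\mathbb R)$ the vector $U(t,t_0)\psi$ lies in the domain of $H(t)$ and $\frac{d}{dt}U(t,t_0)\psi=-iH(t)U(t,t_0)\psi$ in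 norm. **Theorem.** Such functions $c,s$ and an Ermakov–Pinney solution exist; each of $Q^2$, $QP+PQ$, $P^2+Q^2$ generates a unique strongly continuous unitary group; and a unitary evolution $U$ for $H(t)$ exists. Every unitary evolution $U$ for $H(t)$ satisfies the following. 1. For every Ermakov–Pinney solution $\rho$ and all $t,t_0\in I$, $$U(t,t_0)=T_\rho(t)^{-1}R_\rho(t,t_0)\,T_\rho(t_0).$$ 2. In the Schrödinger representation (that is, for $W^{-1}U(t,t_0)W$), for all $t,t_0\in I$ and $\psi\in\mathscr S(\mathbb R)$, $$(U(t,t_0)\psi)(q)=\int_{\mathbb R}K(q,t;q_0,t_0)\,\psi(q_0)\,dq_0\quad\text{for almost every }q.$$ If $s(t,t_0)\ne0$, the integrand is integrable for every $q$, and with the principal square root of $2\pi i$ $$K(q,t;q_0,t_0)=\frac1{\sqrt{2\pi i}}\,s^{-1/2}(t,t_0)\exp\Big(\frac{i}{2s(t,t_0)}\big(c(t_0,t)q^2+c(t,t_0)q_0^2-2qq_0\big)\Big).$$ If $s(t,t_0)=0$, then, as a tempered distribution in $q_0$, $$K(q,t;q_0,t_0)=c^{-1/2}(t,t_0)\exp\Big(\frac{i\,\dot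 c(t,t_0)}{2c(t,t_0)}\,q^2\Big)\,\delta\big(q_0-q/c(t,t_0)\big).$$ -/

import Mathlib

open scoped SchwartzMap

noncomputable section

namespace TDHO

/-! ## The classical equations -/

/-- `u` solves the oscillator equation `u'' + κ u = 0` on the open set `I`. -/
def IsSolution (I : Set ℝ) (κ u : ℝ → ℝ) : Prop :=
  ∀ t ∈ I, DifferentiableAt ℝ u t ∧ HasDerivAt (deriv u) (-(κ t * u t)) t

/-- `ρ` is a (positive) solution of the Ermakov–Pinney equation `ρ'' + κ ρ = 1 / ρ ^ 3` on the
open set `I`. -/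
def IsEPSolution (I : Set ℝ) (κ ρ : ℝ → ℝ) : Prop :=
  ∀ t ∈ I, 0 < ρ t ∧ DifferentiableAt ℝ ρ t ∧
    HasDerivAt (deriv ρ) (1 / ρ t ^ 3 - κ t * ρ t) t

/-- `c(·, t₀)` and `s(·, t₀)` (written `fun t => c t t₀` and `fun t => s t t₀`) are, for every
`t₀ ∈ I`, the solutions of `u'' + κ u = 0` on `I` with
`c(t₀, t₀) = 1`, `c'(t₀, t₀) = 0` and `s(t₀, t₀) = 0`, `s'(t₀, t₀) = 1`. -/
def IsFundamentalPair (I : Set ℝ) (κ : ℝ → ℝ) (c s : ℝ → ℝ → ℝ) : Prop :=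
  ∀ t₀ ∈ I,
    (IsSolution I κ (fun t => c t t₀) ∧ c t₀ t₀ = 1 ∧ deriv (fun t => c t t₀) t₀ = 0) ∧
    (IsSolution I κ (fun t => s t t₀) ∧ s t₀ t₀ = 0 ∧ deriv (fun t => s t t₀) t₀ = 1)

/-- The index `m(u; t, t₀)`: the number of zeros of `u` in `(t₀, t]` if `t₀ ≤ t`, and minus the
number of zeros of `u` in `(t, t₀]` if `t < t₀`. Thus `m(u; t₀, t₀) = 0` and
`m(u; t₂, t₀) - m(u; t₁, t₀)` is the number of zeros of `u` in `(t₁, t₂]` for `t₁ < t₂`. -/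
def zeroIndex (u : ℝ → ℝ) (t t₀ : ℝ) : ℤ :=
  if t₀ ≤ t then ({τ ∈ Set.Ioc t₀ t | u τ = 0}.ncard : ℤ)
  else -({τ ∈ Set.Ioc t t₀ | u τ = 0}.ncard : ℤ)

/-- The power `u ^ ε (t, t₀) = exp (i ε π m(u; t, t₀)) |u(t)| ^ ε` with the Maslov phase. -/
def maslovPow (u : ℝ → ℝ) (ε t t₀ : ℝ) : ℂ :=
  Complex.exp (Complex.I * ε * Real.pi * zeroIndex u t t₀) * ((|u t| ^ ε : ℝ) : ℂ)

/-! ## Quantum operators -/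

/-- The position operator `(Q ψ)(q) = q ψ(q)` on Schwartz functions. -/
def Q : 𝓢(ℝ, ℂ) →L[ℂ] 𝓢(ℝ, ℂ) := SchwartzMap.smulLeftCLM ℂ (fun q : ℝ => (q : ℂ))

/-- The momentum operator `(P ψ)(q) = -i ψ'(q)` on Schwartz functions. -/
def P : 𝓢(ℝ, ℂ) →L[ℂ] 𝓢(ℝ, ℂ) := (-Complex.I) • SchwartzMap.derivCLM ℂ ℂ

theorem Q_apply (ψ : 𝓢(ℝ, ℂ)) (q : ℝ) : Q ψ q = q * ψ q := by
  have h : (fun q : ℝ => (q : ℂ)).HasTemperateGrowth := Complex.ofRealCLM.hasTemperateGrowth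
  simp [Q, SchwartzMap.smulLeftCLM_apply_apply h]

theorem P_apply (ψ : 𝓢(ℝ, ℂ)) (q : ℝ) : P ψ q = -Complex.I * deriv ψ q := by
  simp [P]

/-- The Hilbert space `L²(ℝ, dq)` of the Schrödinger representation. -/
abbrev L2 : Type := MeasureTheory.Lp ℂ 2 (MeasureTheory.volume : MeasureTheory.Measure ℝ)

variable {H : Type*} [NormedAddCommGroup H] [InnerProductSpace ℂ H]

/-- A Schwartz function as a vector of the Hilbert space `H`, which carries the representation
of the canonical commutation relations obtained from the Schrödinger representation
by the unitary `W`. -/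
def embed (W : L2 ≃ₗᵢ[ℂ] H) : 𝓢(ℝ, ℂ) →ₗ[ℂ] H :=
  W.toLinearEquiv.toLinearMap ∘ₗ
    (SchwartzMap.toLpCLM ℂ ℂ 2 (MeasureTheory.volume : MeasureTheory.Measure ℝ)).toLinearMap

theorem embed_apply (W : L2 ≃ₗᵢ[ℂ] H) (ψ : 𝓢(ℝ, ℂ)) :
    embed W ψ = W (ψ.toLp 2 MeasureTheory.volume) := rfl

theorem embed_injective (W : L2 ≃ₗᵢ[ℂ] H) : Function.Injective (embed W) :=
  W.injective.comp (SchwartzMap.injective_toLp 2 MeasureTheory.volume)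

/-- The closed operator in `H` given by an expression `A` in `Q` and `P`: the closure of `A`
from its initial domain, the image of the Schwartz space in `H`. -/
def operator (W : L2 ≃ₗᵢ[ℂ] H) (A : 𝓢(ℝ, ℂ) →L[ℂ] 𝓢(ℝ, ℂ)) : H →ₗ.[ℂ] H :=
  LinearPMap.closure
    { domain := LinearMap.range (embed W)
      toFun := embed W ∘ₗ A.toLinearMap ∘ₗ
        (LinearEquiv.ofInjective (embed W) (embed_injective W)).symm.toLinearMap }

/-- The Hamiltonian `½ (P² + k Q²)`. -/
def hamiltonian (W : L2 ≃ₗᵢ[ℂ] H) (k : ℝ) : H →ₗ.[ℂ] H :=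
  operator W ((1 / 2 : ℂ) • (P ∘L P + (k : ℂ) • (Q ∘L Q)))

/-! ## Unitary groups and exponentials of operators -/

/-- `V` is the strongly continuous one-parameter group of unitary operators `τ ↦ exp (i τ A)`,
that is, the operator `A` is its infinitesimal generator: `χ = A φ` if and only if
`τ ↦ V τ φ` is differentiable at `0` with derivative `i χ`. -/
structure IsUnitaryGroupOf (A : H →ₗ.[ℂ] H) (V : ℝ → H ≃ₗᵢ[ℂ] H) : Prop where
  zero : V 0 = 1
  add : ∀ σ τ, V (σ + τ) = V σ * V τ
  continuous : ∀ φ : H, Continuous (fun τ => V τ φ)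
  generator : ∀ φ χ : H,
    (φ, χ) ∈ A.graph ↔ HasDerivAt (fun τ : ℝ => V τ φ) (Complex.I • χ) 0

/-- `exp (i τ A)`, the value at `τ` of the unitary group generated by `A`. -/
def expI (A : H →ₗ.[ℂ] H) (τ : ℝ) : H ≃ₗᵢ[ℂ] H :=
  Classical.epsilon (IsUnitaryGroupOf A) τ

/-- The operator `D(x) = exp (-(i/2) x Q²)`, which displaces the momentum. -/
def D (W : L2 ≃ₗᵢ[ℂ] H) (x : ℝ) : H ≃ₗᵢ[ℂ] H :=
  expI (operator W (Q ∘L Q)) (-x / 2)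

/-- The squeeze operator `S(y) = exp ((i/2) y (Q P + P Q))`. -/
def S (W : L2 ≃ₗᵢ[ℂ] H) (y : ℝ) : H ≃ₗᵢ[ℂ] H :=
  expI (operator W (Q ∘L P + P ∘L Q)) (y / 2)

/-- The operator `T_ρ(t) = S_ρ(t) D_ρ(t)`, where `D_ρ(t) = D(ρ'(t) / ρ(t))` and
`S_ρ(t) = S(log ρ(t))`. -/
def T (W : L2 ≃ₗᵢ[ℂ] H) (ρ : ℝ → ℝ) (t : ℝ) : H ≃ₗᵢ[ℂ] H :=
  S W (Real.log (ρ t)) * D W (deriv ρ t / ρ t)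

/-- The rotation operator `R_ρ(t, t₀) = exp (-(i/2) (∫_{t₀}^t dτ / ρ(τ)²) (P² + Q²))`. -/
def R (W : L2 ≃ₗᵢ[ℂ] H) (ρ : ℝ → ℝ) (t t₀ : ℝ) : H ≃ₗᵢ[ℂ] H :=
  expI (operator W (P ∘L P + Q ∘L Q)) (-(∫ τ in t₀..t, 1 / ρ τ ^ 2) / 2)

/-! ## The evolution operator and the propagator -/

/-- `U(t, t₀)`, `t, t₀ ∈ I`, is the unitary evolution generated by `H(t) = ½ (P² + κ(t) Q²)`:
a strongly continuous two-parameter family of unitary operators with the composition law, such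
that for every Schwartz initial state `ψ` the vector `U(t, t₀) ψ` stays in the domain of `H(t)`
and solves the Schrödinger equation `dU(t, t₀) ψ / dt = -i H(t) U(t, t₀) ψ`. -/
structure IsEvolution (W : L2 ≃ₗᵢ[ℂ] H) (I : Set ℝ) (κ : ℝ → ℝ)
    (U : ℝ → ℝ → H ≃ₗᵢ[ℂ] H) : Prop where
  refl : ∀ t ∈ I, U t t = 1
  comp : ∀ t₂ ∈ I, ∀ t₁ ∈ I, ∀ t₀ ∈ I, U t₂ t₁ * U t₁ t₀ = U t₂ t₀
  continuousOn : ∀ φ : H, ContinuousOn (fun p : ℝ × ℝ => U p.1 p.2 φ) (I ×ˢ I)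
  schrodinger : ∀ t₀ ∈ I, ∀ t ∈ I, ∀ ψ : 𝓢(ℝ, ℂ), ∃ χ : H,
    (U t t₀ (embed W ψ), χ) ∈ (hamiltonian W (κ t)).graph ∧
    HasDerivAt (fun τ : ℝ => U τ t₀ (embed W ψ)) (-(Complex.I • χ)) t

/-- The propagator `K(q, t; q₀, t₀)` at times with `s(t, t₀) ≠ 0`. -/
def propagator (c s : ℝ → ℝ → ℝ) (q t q₀ t₀ : ℝ) : ℂ :=
  (2 * Real.pi * Complex.I) ^ (-(1 / 2) : ℂ) * maslovPow (fun τ => s τ t₀) (-(1 / 2)) t t₀ *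
    Complex.exp (Complex.I / (2 * s t t₀) *
      (c t₀ t * q ^ 2 + c t t₀ * q₀ ^ 2 - 2 * q * q₀))

/-- The propagator `K(q, t; ·, t₀)` at times with `s(t, t₀) = 0`, as a tempered distribution in
the variable `q₀`: a multiple of the Dirac distribution `δ(q₀ - q / c(t, t₀))`. -/
def causticPropagator (c : ℝ → ℝ → ℝ) (q t t₀ : ℝ) : 𝓢'(ℝ, ℂ) :=
  (maslovPow (fun τ => c τ t₀) (-(1 / 2)) t t₀ *
    Complex.exp (Complex.I * deriv (fun τ => c τ t₀) t / (2 * c t t₀) * q ^ 2)) •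
    TemperedDistribution.delta (q / c t t₀)

end TDHO

end

noncomputable section

namespace TDHO

open MeasureTheory Filter Topology FourierTransform

/-! Everything is explicit on the Schwartz space. Chirps, dilations and the Fourier transform
generate all the unitaries that are needed, as elements of the group `SchwartzUnitary`, and `lift`
extends them to the Hilbert space by density. Two facts bring the analysis back to this group. By
`solution_eq`, a differentiable unitary family on the Schwartz space determines every solution of
its evolution equation, because pairing a solution with the family gives a constant. By
`isUnitaryGroupOf_lift`, a differentiable group on the Schwartz space is the unitary group of the
closure of its generator. Hence D, S and R are lifts of `chirp`, `squeeze` and `rot`, and every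
evolution is a lift as soon as one solution family is known.

That family is a chirp times a dilation times a rotation with rescaled time. By
`hasGen_chirp_mul_squeeze_mul` such a product solves the Schrödinger equation when its parameters
satisfy a Riccati equation, and for the chirp ρ'/ρ and the scale 1/ρ this is the Ermakov–Pinney
equation (`hasGen_epEvolution`).

The same lemma with κ = 1 builds the rotation by |θ| < π/2 from the free evolution, whose kernel is
a Fresnel integral. Charts around the multiples of π/2 are glued by the quarter turn, the Fourier
transform times exp(-iπ/4). The square of the quarter turn is -i times parity, and this is the
source of the Maslov phase: the rotation by θ has the Mehler kernel with the factor (-i)^⌊θ/π⌋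
(`rot_apply`).

Finally s = ρ(t)ρ(t₀) sin θ, where θ is the phase ∫ρ⁻². Since θ is strictly increasing, ⌊θ/π⌋ counts
the zeros of s (`zeroIndex_eq`), and a change of variables turns the Mehler kernel into the
propagator. At s = 0 the rotation is a power of -i times parity, which gives the Dirac kernel. -/

/-- The Schwartz space. -/
abbrev Sch : Type := 𝓢(ℝ, ℂ)

/-- The embedding of the Schwartz space in `L²`. -/
abbrev toL2 : Sch →L[ℂ] L2 := SchwartzMap.toLpCLM ℂ ℂ 2 (volume : Measure ℝ)

theorem denseRange_toL2 : DenseRange toL2 :=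
  SchwartzMap.denseRange_toLpCLM (F := ℂ) (p := 2) (μ := (volume : Measure ℝ)) (by simp)

theorem inner_toL2 (φ ψ : Sch) : inner ℂ (toL2 φ) (toL2 ψ) = ∫ x, inner ℂ (φ x) (ψ x) := by
  simp [toL2]

/-- The linear automorphisms of the Schwartz space that preserve the `L²` norm. -/
def SchwartzUnitary : Subgroup (Sch ≃ₗ[ℂ] Sch) where
  carrier := {a | ∀ ψ, ‖toL2 (a ψ)‖ = ‖toL2 ψ‖}
  mul_mem' {a b} ha hb ψ := (ha (b ψ)).trans (hb ψ)
  one_mem' _ := rfl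
  inv_mem' {a} ha ψ := by
    have := ha (a.symm ψ)
    rw [LinearEquiv.apply_symm_apply] at this
    exact this.symm

instance : CoeFun SchwartzUnitary (fun _ => Sch → Sch) := ⟨fun a => a.1⟩

namespace SchwartzUnitary

theorem mul_apply (a b : SchwartzUnitary) (ψ : Sch) : (a * b) ψ = a (b ψ) := rfl

theorem one_apply (ψ : Sch) : (1 : SchwartzUnitary) ψ = ψ := rfl

theorem inv_apply_self (a : SchwartzUnitary) (ψ : Sch) : a⁻¹ (a ψ) = ψ :=
  LinearEquiv.symm_apply_apply a.1 ψ

theorem apply_inv_self (a : SchwartzUnitary) (ψ : Sch) : a (a⁻¹ ψ) = ψ :=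
  LinearEquiv.apply_symm_apply a.1 ψ

theorem norm_apply (a : SchwartzUnitary) (ψ : Sch) : ‖toL2 (a ψ)‖ = ‖toL2 ψ‖ := a.2 ψ

theorem ext {a b : SchwartzUnitary} (h : ∀ ψ, a ψ = b ψ) : a = b :=
  Subtype.ext (LinearEquiv.ext h)

end SchwartzUnitary

/-! ### Extension of Schwartz-space unitaries to the Hilbert space. -/

section Extension

variable {H : Type*} [NormedAddCommGroup H] [InnerProductSpace ℂ H] (W : L2 ≃ₗᵢ[ℂ] H)

theorem embed_eq (ψ : Sch) : embed W ψ = W (toL2 ψ) := rfl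

theorem norm_embed (ψ : Sch) : ‖embed W ψ‖ = ‖toL2 ψ‖ := W.norm_map _

theorem inner_embed (φ ψ : Sch) :
    inner ℂ (embed W φ) (embed W ψ) = inner ℂ (toL2 φ) (toL2 ψ) := W.inner_map_map _ _

theorem denseRange_embed : DenseRange (embed W) :=
  W.surjective.denseRange.comp denseRange_toL2 W.continuous

include W in
theorem completeSpace_of_unitary : CompleteSpace H :=
  (W.isometry.isUniformInducing.completeSpace_congr W.surjective).1 inferInstance

/-- The unitary operator that extends a unitary automorphism of the Schwartz space. -/
def lift (a : SchwartzUnitary) : H ≃ₗᵢ[ℂ] H :=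
  (W.symm.trans (LinearEquiv.extendOfIsometry a.1 toL2.toLinearMap toL2.toLinearMap
    denseRange_toL2 denseRange_toL2 a.2)).trans W

theorem lift_embed (a : SchwartzUnitary) (ψ : Sch) :
    lift W a (embed W ψ) = embed W (a ψ) := by
  simp only [lift, embed_eq, LinearIsometryEquiv.trans_apply, LinearIsometryEquiv.symm_apply_apply]
  congr 1
  exact LinearEquiv.extendOfIsometry_eq a.1 toL2.toLinearMap toL2.toLinearMap
    denseRange_toL2 denseRange_toL2 a.2 ψ

theorem eq_of_embed {X : Type*} [TopologicalSpace X] [T2Space X] {f g : H → X} (hf : Continuous f)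
    (hg : Continuous g) (h : ∀ ψ, f (embed W ψ) = g (embed W ψ)) (x : H) : f x = g x :=
  congrFun ((denseRange_embed W).equalizer hf hg (funext h)) x

variable {W} in
theorem unitary_ext {U V : H ≃ₗᵢ[ℂ] H} (h : ∀ ψ, U (embed W ψ) = V (embed W ψ)) : U = V := by
  ext x
  exact eq_of_embed W U.continuous V.continuous h x

theorem lift_mul (a b : SchwartzUnitary) : lift W (a * b) = lift W a * lift W b :=
  unitary_ext (W := W) fun ψ => by
    simp only [LinearIsometryEquiv.coe_mul, Function.comp_apply, lift_embed]; rfl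

theorem lift_one : lift W 1 = 1 :=
  unitary_ext (W := W) fun ψ => by simp only [lift_embed]; rfl

theorem lift_inv (a : SchwartzUnitary) : lift W a⁻¹ = (lift W a)⁻¹ :=
  eq_inv_of_mul_eq_one_left (by rw [← lift_mul, inv_mul_cancel, lift_one])

end Extension

/-! ### Differentiable families -/

/-- The family `a` of unitary automorphisms of the Schwartz space is, at `t`, differentiable in
`L²` with derivative `G a(t)`. -/
def HasGen (a : ℝ → SchwartzUnitary) (G : Sch → Sch) (t : ℝ) : Prop :=
  ∀ ψ, HasDerivAt (fun τ => toL2 (a τ ψ)) (toL2 (G (a t ψ))) t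

theorem HasGen.congr {a : ℝ → SchwartzUnitary} {G G' : Sch → Sch} {t : ℝ} (h : HasGen a G t)
    (hG : ∀ ψ, G ψ = G' ψ) : HasGen a G' t := fun ψ => by rw [← hG]; exact h ψ

theorem HasGen.congr_of_eventuallyEq {a b : ℝ → SchwartzUnitary} {G : Sch → Sch} {t : ℝ}
    (h : HasGen a G t) (hab : b =ᶠ[nhds t] a) : HasGen b G t := fun ψ => by
  rw [hab.eq_of_nhds]
  exact (h ψ).congr_of_eventuallyEq (hab.mono fun τ hτ => by simp only [hτ])

theorem hasGen_const (a : SchwartzUnitary) (t : ℝ) : HasGen (fun _ => a) (fun _ => 0) t :=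
  fun ψ => by
    rw [map_zero]
    exact hasDerivAt_const t (toL2 (a ψ))

theorem HasGen.comp {a : ℝ → SchwartzUnitary} {G : Sch → Sch} {f : ℝ → ℝ} {f' t : ℝ}
    (h : HasGen a G (f t)) (hf : HasDerivAt f f' t) :
    HasGen (fun τ => a (f τ)) (fun ψ => (f' : ℂ) • G ψ) t := fun ψ => by
  have := (h ψ).scomp t hf
  simpa [Function.comp_def] using this

/-- The product rule for strongly differentiable families. -/
theorem HasGen.mul {a b : ℝ → SchwartzUnitary} {G K : Sch → Sch} {t : ℝ} (ha : HasGen a G t)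
    (hb : HasGen b K t) :
    HasGen (fun τ => a τ * b τ) (fun ψ => G ψ + a t (K ((a t)⁻¹ ψ))) t := fun ψ => by
  have e : (a t)⁻¹ ((a t * b t) ψ) = b t ψ := SchwartzUnitary.inv_apply_self _ _
  change HasDerivAt (fun τ => toL2 (a τ (b τ ψ)))
    (toL2 (G (a t (b t ψ)) + a t (K ((a t)⁻¹ ((a t * b t) ψ))))) t
  rw [e, map_add]
  set φ := b t ψ with hφ
  have h1 := ha φ
  -- Only the norm of `a τ` is controlled on varying vectors. So the increment of `b` is split into
  -- its linear part, where strong continuity of `a` at the fixed vector `K φ` suffices, and a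
  -- remainder, whose norm `a τ` preserves.
  have h2 : HasDerivAt (fun τ => toL2 (a τ (b τ ψ - φ))) (toL2 (a t (K φ))) t := by
    rw [hasDerivAt_iff_isLittleO]
    have h3 := (hasDerivAt_iff_isLittleO.1 (hb ψ))
    have h4 : (fun τ => toL2 (a τ (K φ)) - toL2 (a t (K φ))) =o[nhds t] (fun _ => (1 : ℝ)) := by
      rw [Asymptotics.isLittleO_one_iff, ← sub_self (toL2 (a t (K φ)))]
      exact ((ha (K φ)).continuousAt.tendsto).sub tendsto_const_nhds
    have h5 : (fun τ => (τ - t) • (toL2 (a τ (K φ)) - toL2 (a t (K φ)))) =o[nhds t]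
        (fun τ => τ - t) := by
      simpa using (Asymptotics.isBigO_refl (fun τ => τ - t) (nhds t)).smul_isLittleO h4
    have h6 : (fun τ => toL2 (a τ (b τ ψ - φ - ((τ - t : ℝ) : ℂ) • K φ))) =o[nhds t]
        (fun τ => τ - t) := by
      refine Asymptotics.IsLittleO.of_norm_left ?_
      simp only [SchwartzUnitary.norm_apply]
      refine Asymptotics.IsLittleO.norm_left (h3.congr_left fun τ => ?_)
      rw [map_sub, map_sub, map_smul, Complex.coe_smul, hφ]
      rfl
    refine (h6.add h5).congr_left fun τ => ?_
    have : (a t) (b t ψ - φ) = 0 := by rw [hφ, sub_self]; exact map_zero (a t).1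
    rw [this]
    change toL2 ((a τ).1 _) + _ = toL2 ((a τ).1 _) - _ - _
    rw [map_sub (a τ).1, map_smul (a τ).1, map_sub, map_smul, map_zero, Complex.coe_smul, smul_sub,
      sub_zero]
    exact sub_add_sub_cancel _ _ _
  refine (h1.add h2).congr_of_eventuallyEq (Filter.Eventually.of_forall fun τ => ?_)
  simp only [Pi.add_apply, ← map_add]
  congr 1
  rw [add_sub_cancel]

theorem HasGen.const_mul {b : ℝ → SchwartzUnitary} {K : Sch → Sch} {t : ℝ} (a : SchwartzUnitary)
    (hb : HasGen b K t) :
    HasGen (fun τ => a * b τ) (fun ψ => a (K (a⁻¹ ψ))) t :=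
  ((hasGen_const a t).mul hb).congr fun ψ => by simp

theorem HasGen.mul_const {a : ℝ → SchwartzUnitary} {G : Sch → Sch} {t : ℝ} (ha : HasGen a G t)
    (b : SchwartzUnitary) : HasGen (fun τ => a τ * b) G t :=
  (ha.mul (hasGen_const b t)).congr fun ψ => by
    change _ + (a t).1 0 = _
    simp

/-! ### Closures of symmetric operators and uniqueness of evolutions. -/

section Evolution

variable {H : Type*} [NormedAddCommGroup H] [InnerProductSpace ℂ H] {W : L2 ≃ₗᵢ[ℂ] H}

theorem HasGen.embed {a : ℝ → SchwartzUnitary} {G : Sch → Sch} {t : ℝ} (h : HasGen a G t)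
    (ψ : Sch) :
    HasDerivAt (fun τ => embed W (a τ ψ)) (TDHO.embed W (G (a t ψ))) t := by
  have := (W.toContinuousLinearEquiv.toContinuousLinearMap.hasFDerivAt
    (x := toL2 (a t ψ))).restrictScalars ℝ |>.comp_hasDerivAt t (h ψ)
  exact this

/-- A symmetric operator on the Schwartz space. -/
def IsSymm (A : Sch → Sch) : Prop :=
  ∀ φ ψ, inner ℂ (toL2 φ) (toL2 (A ψ)) = inner ℂ (toL2 (A φ)) (toL2 ψ)

/-- `LinearPMap.closure` is the closure of the graph only for a closable operator. A symmetric
operator on a dense domain is closable: if (0, y) is a limit of points of the graph, then y is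
orthogonal to every Schwartz vector. -/
theorem mem_graph_operator_iff {A : Sch →L[ℂ] Sch} (hA : IsSymm A) (x y : H) :
    (x, y) ∈ (operator W A).graph ↔
      (x, y) ∈ closure (Set.range fun ψ : Sch => (embed W ψ, embed W (A ψ))) := by
  set f : H →ₗ.[ℂ] H :=
    { domain := LinearMap.range (embed W)
      toFun := embed W ∘ₗ A.toLinearMap ∘ₗ
        (LinearEquiv.ofInjective (embed W) (embed_injective W)).symm.toLinearMap } with hf
  have hf' : ∀ ψ, f ⟨embed W ψ, ψ, rfl⟩ = embed W (A ψ) := fun ψ =>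
    congrArg (fun φ => embed W (A φ))
      ((LinearEquiv.ofInjective (embed W) (embed_injective W)).symm_apply_apply ψ)
  have hgr : ∀ p : H × H, p ∈ f.graph ↔ p ∈ Set.range fun ψ : Sch => (embed W ψ, embed W (A ψ)) := by
    rintro ⟨p, q⟩
    rw [LinearPMap.mem_graph_iff]
    constructor
    · rintro ⟨⟨_, ψ, rfl⟩, h1, h2⟩
      refine ⟨ψ, Prod.ext h1 ?_⟩
      rw [← h2]
      exact (hf' ψ).symm
    · rintro ⟨ψ, h⟩
      simp only [Prod.mk.injEq] at h
      exact ⟨⟨embed W ψ, ψ, rfl⟩, h.1, (hf' ψ).trans h.2⟩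
  have hset : (f.graph : Set (H × H)) = Set.range fun ψ : Sch => (embed W ψ, embed W (A ψ)) :=
    Set.ext hgr
  have hsym : ∀ p ∈ closure (Set.range fun ψ : Sch => (embed W ψ, embed W (A ψ))), ∀ φ : Sch,
      inner ℂ (embed W φ) p.2 = inner ℂ (embed W (A φ)) p.1 := by
    intro p hp φ
    refine closure_minimal (s := _) (t := {p : H × H | inner ℂ (embed W φ) p.2 =
      inner ℂ (embed W (A φ)) p.1}) ?_ (isClosed_eq (by fun_prop) (by fun_prop)) hp
    rintro _ ⟨ψ, rfl⟩
    simp only [Set.mem_ofPred_eq, inner_embed]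
    exact hA φ ψ
  have hcl : f.IsClosable := by
    refine ⟨f.graph.topologicalClosure.toLinearPMap, ?_⟩
    rw [Submodule.toLinearPMap_graph_eq]
    intro p hp hp0
    have hp' : p ∈ closure (Set.range fun ψ : Sch => (embed W ψ, embed W (A ψ))) := by
      rw [← hset]; exact hp
    have h0 : ∀ φ : Sch, inner ℂ (embed W φ) p.2 = 0 := fun φ => by
      rw [hsym p hp' φ, hp0, inner_zero_right]
    exact inner_self_eq_zero.1 (eq_of_embed W (f := fun v : H => inner ℂ v p.2)
      (g := fun _ => (0 : ℂ)) (by fun_prop) (by fun_prop) h0 p.2)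
  change (x, y) ∈ f.closure.graph ↔ _
  rw [← hcl.graph_closure_eq_closure_graph, ← hset]
  rfl

theorem mem_graph_operator {A : Sch →L[ℂ] Sch} (hA : IsSymm A) (ψ : Sch) :
    (embed W ψ, embed W (A ψ)) ∈ (operator W A).graph :=
  (mem_graph_operator_iff hA _ _).2 (subset_closure ⟨ψ, rfl⟩)

/-- The closure is contained in the adjoint, since the symmetry relation is a closed condition on
the graph. -/
theorem inner_graph_operator {A : Sch →L[ℂ] Sch} (hA : IsSymm A) {x y : H}
    (h : (x, y) ∈ (operator W A).graph) (φ : Sch) :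
    inner ℂ (embed W φ) y = inner ℂ (embed W (A φ)) x := by
  refine closure_minimal (t := {p : H × H | inner ℂ (embed W φ) p.2 =
    inner ℂ (embed W (A φ)) p.1}) ?_ (isClosed_eq (by fun_prop) (by fun_prop))
    ((mem_graph_operator_iff hA _ _).1 h)
  rintro _ ⟨ψ, rfl⟩
  simp only [Set.mem_ofPred_eq, inner_embed]
  exact hA φ ψ

/-- Uniqueness for the equation `u' = z A(t) u`, `z` imaginary and `A(t)` symmetric, if there is a
family of unitary solution operators that preserves the Schwartz space. -/
theorem solution_eq {I : Set ℝ} (hI : IsOpen I) (hI' : I.OrdConnected) {z : ℂ}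
    (hz : (starRingEnd ℂ) z = -z) {A : ℝ → Sch →L[ℂ] Sch} (hA : ∀ t, IsSymm (A t))
    {a : ℝ → SchwartzUnitary} (ha : ∀ t ∈ I, HasGen a (fun ψ => z • A t ψ) t)
    {u : ℝ → H} (hu : ∀ t ∈ I, ∃ χ, (u t, χ) ∈ (operator W (A t)).graph ∧
      HasDerivAt u (z • χ) t) {t t₀ : ℝ} (ht : t ∈ I) (ht₀ : t₀ ∈ I) :
    u t = lift W (a t) ((lift W (a t₀))⁻¹ (u t₀)) := by
  -- The two terms of the derivative cancel because z is imaginary. The vector `a τ φ` remains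
  -- Schwartz, so `A τ` can be moved onto it although `u τ` is only in the domain of the closure.
  have key : ∀ φ : Sch, inner ℂ (embed W (a t φ)) (u t) = inner ℂ (embed W (a t₀ φ)) (u t₀) := by
    intro φ
    have hd : ∀ τ ∈ I, HasDerivAt (fun τ => inner ℂ (embed W (a τ φ)) (u τ)) 0 τ := by
      intro τ hτ
      obtain ⟨χ, hχ, hd⟩ := hu τ hτ
      have h1 := ((ha τ hτ).embed (W := W) φ).inner ℂ hd
      rw [map_smul, inner_smul_left, inner_smul_right, hz, inner_graph_operator (hA τ) hχ] at h1
      simpa using h1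
    refine hI.is_const_of_deriv_eq_zero hI'.isPreconnected
      (f := fun τ => inner ℂ (embed W (a τ φ)) (u τ))
      (fun τ hτ => (hd τ hτ).differentiableAt.differentiableWithinAt)
      (fun τ hτ => (hd τ hτ).deriv) ht ht₀
  have h2 := eq_of_embed W (f := fun v : H => inner ℂ (lift W (a t) v) (u t))
      (g := fun v => inner ℂ (lift W (a t₀) v) (u t₀))
      (by fun_prop) (by fun_prop) (fun φ => by simp only [lift_embed, key])
  have h3 : (lift W (a t))⁻¹ (u t) = (lift W (a t₀))⁻¹ (u t₀) := by
    refine ext_inner_left ℂ fun v => ?_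
    rw [← (lift W (a t)).inner_map_map, ← (lift W (a t₀)).inner_map_map v]
    have e1 : lift W (a t) ((lift W (a t))⁻¹ (u t)) = u t :=
      (lift W (a t)).apply_symm_apply _
    have e2 : lift W (a t₀) ((lift W (a t₀))⁻¹ (u t₀)) = u t₀ :=
      (lift W (a t₀)).apply_symm_apply _
    rw [e1, e2]
    exact h2 v
  rw [← h3]
  exact ((lift W (a t)).apply_symm_apply _).symm

end Evolution

/-! ### Unitary groups on the Schwartz space and their generators. -/

section Group

variable {H : Type*} [NormedAddCommGroup H] [InnerProductSpace ℂ H] {W : L2 ≃ₗᵢ[ℂ] H}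

/-- A unitary family that is strongly differentiable on the Schwartz space is strongly
continuous. -/
theorem continuousOn_lift {I : Set ℝ} {a : ℝ → SchwartzUnitary} {G : ℝ → Sch → Sch}
    (ha : ∀ t ∈ I, HasGen a (G t) t) (x : H) : ContinuousOn (fun t => lift W (a t) x) I := by
  refine continuousOn_of_uniform_approx_of_continuousOn fun u hu => ?_
  obtain ⟨ε, hε, hεu⟩ := Metric.mem_uniformity_dist.1 hu
  obtain ⟨ψ, hψ⟩ := (denseRange_embed W).exists_dist_lt x hε
  refine ⟨fun t => lift W (a t) (embed W ψ), fun t ht => ?_, fun t _ => hεu ?_⟩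
  · simp only [lift_embed]
    exact ((ha t ht).embed ψ).continuousAt.continuousWithinAt
  · rwa [LinearIsometryEquiv.dist_map]

/-- Applying the isometry of `a t` turns the difference of the inverses at x into the difference of
`a t₀` and `a t` at the fixed vector (a t₀)⁻¹x. -/
theorem continuousOn_lift_inv {I : Set ℝ} {a : ℝ → SchwartzUnitary} {G : ℝ → Sch → Sch}
    (ha : ∀ t ∈ I, HasGen a (G t) t) (x : H) :
    ContinuousOn (fun t => (lift W (a t))⁻¹ x) I := by
  intro t₀ ht₀
  rw [ContinuousWithinAt, tendsto_iff_norm_sub_tendsto_zero]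
  have h := continuousOn_lift (W := W) ha ((lift W (a t₀))⁻¹ x) t₀ ht₀
  rw [ContinuousWithinAt, tendsto_iff_norm_sub_tendsto_zero] at h
  refine h.congr fun t => ?_
  have e1 : ∀ s (y : H), lift W (a s) ((lift W (a s))⁻¹ y) = y :=
    fun s y => (lift W (a s)).apply_symm_apply y
  rw [e1, ← (lift W (a t)).norm_map ((lift W (a t))⁻¹ x - (lift W (a t₀))⁻¹ x), map_sub, e1,
    norm_sub_rev]

theorem continuousOn_lift_mul_inv {I : Set ℝ} {a : ℝ → SchwartzUnitary} {G : ℝ → Sch → Sch}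
    (ha : ∀ t ∈ I, HasGen a (G t) t) (x : H) :
    ContinuousOn (fun p : ℝ × ℝ => lift W (a p.1) ((lift W (a p.2))⁻¹ x)) (I ×ˢ I) := by
  rintro ⟨t, s⟩ ⟨ht, hs⟩
  rw [ContinuousWithinAt, tendsto_iff_norm_sub_tendsto_zero]
  have h1 := continuousOn_lift (W := W) ha ((lift W (a s))⁻¹ x) t ht
  rw [ContinuousWithinAt, tendsto_iff_norm_sub_tendsto_zero] at h1
  have h2 := continuousOn_lift_inv (W := W) ha x s hs
  rw [ContinuousWithinAt, tendsto_iff_norm_sub_tendsto_zero] at h2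
  have h1' := h1.comp (f := Prod.fst) (x := nhdsWithin (t, s) (I ×ˢ I)) (by
    rw [nhdsWithin_prod_eq]; exact Filter.tendsto_fst)
  have h2' := h2.comp (f := Prod.snd) (x := nhdsWithin (t, s) (I ×ˢ I)) (by
    rw [nhdsWithin_prod_eq]; exact Filter.tendsto_snd)
  have h3 := h2'.add h1'
  rw [add_zero] at h3
  refine squeeze_zero (fun _ => norm_nonneg _) (fun p => ?_) h3
  simp only [Function.comp_apply]
  rw [← (lift W (a p.1)).norm_map ((lift W (a p.2))⁻¹ x - (lift W (a s))⁻¹ x), map_sub]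
  exact norm_sub_le_norm_sub_add_norm_sub _ _ _

variable {A : Sch →L[ℂ] Sch} {V : ℝ → SchwartzUnitary}

/-- The group law is not assumed: the translated family solves the same equation in s, so it follows
from uniqueness. -/
theorem lift_add_of_hasGen (hA : IsSymm A) (h0 : V 0 = 1)
    (hV : ∀ t, HasGen V (fun ψ => Complex.I • A ψ) t) (s t : ℝ) :
    lift W (V (s + t)) = lift W (V s) * lift W (V t) := by
  refine unitary_ext (W := W) fun ψ => ?_
  have h := solution_eq (W := W) (I := Set.univ) isOpen_univ Set.ordConnected_univ (z := Complex.I)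
    (by simp) (A := fun _ => A) (fun _ => hA) (a := V) (fun t _ => hV t)
    (u := fun τ => embed W (V (τ + t) ψ))
    (fun τ _ => ⟨embed W (A (V (τ + t) ψ)), mem_graph_operator hA _, by
      have := (hV (τ + t)).embed (W := W) ψ
      rw [map_smul] at this
      exact this.comp_add_const τ t⟩) (Set.mem_univ s) (Set.mem_univ 0)
  simp only [zero_add, h0, lift_one] at h
  rw [lift_embed, h, LinearIsometryEquiv.coe_mul, Function.comp_apply, lift_embed]
  rfl

/-- The identity V(τ)x - x = ∫₀^τ V(σ) i y dσ holds on Schwartz vectors and survives limits in the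
graph norm, unlike differentiability itself. Differentiating the integral at 0 then gives the claim.
-/
theorem hasDerivAt_zero_of_mem_graph (hA : IsSymm A) (h0 : V 0 = 1)
    (hV : ∀ t, HasGen V (fun ψ => Complex.I • A ψ) t) {x y : H}
    (hxy : (x, y) ∈ (operator W A).graph) :
    HasDerivAt (fun τ => lift W (V τ) x) (Complex.I • y) 0 := by
  have := completeSpace_of_unitary W
  have hcont : ∀ y : H, Continuous fun τ => lift W (V τ) y := fun y =>
    continuousOn_univ.1 (continuousOn_lift (W := W) (fun t _ => hV t) y)
  have hd : ∀ ψ : Sch, ∀ τ, HasDerivAt (fun τ => lift W (V τ) (embed W ψ))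
      (lift W (V τ) (Complex.I • embed W (A ψ))) τ := by
    intro ψ τ
    have h1 : HasDerivAt (fun σ => lift W (V σ) (embed W ψ)) (Complex.I • embed W (A ψ)) 0 := by
      have := (hV 0).embed (W := W) ψ
      rw [h0, map_smul] at this
      simp only [lift_embed]
      exact this
    have h2 : HasDerivAt (fun σ => lift W (V τ) (lift W (V σ) (embed W ψ)))
        (lift W (V τ) (Complex.I • embed W (A ψ))) 0 :=
      ((lift W (V τ)).toContinuousLinearEquiv.toContinuousLinearMap.hasFDerivAt.restrictScalars
        ℝ).comp_hasDerivAt 0 h1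
    have h3 : HasDerivAt (fun σ => lift W (V (τ + σ)) (embed W ψ))
        (lift W (V τ) (Complex.I • embed W (A ψ))) 0 := by
      refine h2.congr_of_eventuallyEq (Filter.Eventually.of_forall fun σ => ?_)
      simp only [lift_add_of_hasGen hA h0 hV, LinearIsometryEquiv.coe_mul, Function.comp_apply]
    have h4 := HasDerivAt.comp_sub_const (f := fun σ => lift W (V (τ + σ)) (embed W ψ)) (x := τ) (a := τ)
      (by rw [sub_self]; exact h3)
    simpa using h4
  have hint : ∀ τ, lift W (V τ) x - x = ∫ σ in (0 : ℝ)..τ, lift W (V σ) (Complex.I • y) := by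
    intro τ
    refine eq_of_forall_dist_le fun ε hε => ?_
    -- The error is at most twice the distance in x plus |τ| times the distance in y, hence the
    -- factor 2 + |τ|.
    obtain ⟨_, ⟨ψ, rfl⟩, hψ⟩ := Metric.mem_closure_iff.1 ((mem_graph_operator_iff hA _ _).1 hxy)
      (ε / (2 + |τ|)) (by positivity)
    rw [Prod.dist_eq, max_lt_iff] at hψ
    simp only [dist_eq_norm] at hψ ⊢
    have e := intervalIntegral.integral_eq_sub_of_hasDerivAt (a := 0) (b := τ)
      (fun σ _ => hd ψ σ) ((hcont _).intervalIntegrable _ _)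
    have hb : ‖(∫ σ in (0 : ℝ)..τ, lift W (V σ) (Complex.I • y)) -
        ∫ σ in (0 : ℝ)..τ, lift W (V σ) (Complex.I • embed W (A ψ))‖ ≤
        ‖y - embed W (A ψ)‖ * |τ - 0| := by
      rw [← intervalIntegral.integral_sub ((hcont _).intervalIntegrable _ _)
        ((hcont _).intervalIntegrable _ _)]
      refine intervalIntegral.norm_integral_le_of_norm_le_const fun σ _ => ?_
      rw [← map_sub, LinearIsometryEquiv.norm_map, ← smul_sub, norm_smul, Complex.norm_I, one_mul]
    rw [e, h0, lift_one, sub_zero] at hb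
    have e2 : lift W (V τ) x - x - ∫ σ in (0 : ℝ)..τ, lift W (V σ) (Complex.I • y) =
        lift W (V τ) (x - embed W ψ) - (x - embed W ψ) -
        ((∫ σ in (0 : ℝ)..τ, lift W (V σ) (Complex.I • y)) -
          (lift W (V τ) (embed W ψ) - (1 : H ≃ₗᵢ[ℂ] H) (embed W ψ))) := by
      rw [map_sub, LinearIsometryEquiv.coe_one, id]
      abel
    rw [e2]
    calc _ ≤ (‖x - embed W ψ‖ + ‖x - embed W ψ‖) + ‖y - embed W (A ψ)‖ * |τ| := by
          refine (norm_sub_le _ _).trans (add_le_add ((norm_sub_le _ _).trans ?_) hb)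
          rw [LinearIsometryEquiv.norm_map]
      _ ≤ (ε / (2 + |τ|) + ε / (2 + |τ|)) + ε / (2 + |τ|) * |τ| := by
          gcongr
          exacts [hψ.1.le, hψ.1.le, hψ.2.le]
      _ = ε := by field_simp; ring
  have h1 : HasDerivAt (fun τ => ∫ σ in (0 : ℝ)..τ, lift W (V σ) (Complex.I • y))
      (lift W (V 0) (Complex.I • y)) 0 :=
    intervalIntegral.integral_hasDerivAt_right ((hcont _).intervalIntegrable _ _)
      ((hcont _).stronglyMeasurableAtFilter _ _) (hcont _).continuousAt
  rw [h0, lift_one] at h1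
  have h2 := h1.add_const x
  refine h2.congr_of_eventuallyEq (Filter.Eventually.of_forall fun τ => ?_)
  simp only [← hint, sub_add_cancel]

/-- The range of A + i on the Schwartz space is dense, and ‖q + ip‖² = ‖q‖² + ‖p‖² for pairs of the
generator. So a Schwartz ψ with (A + i)ψ near y + ix has (ψ, Aψ) near (x, y), which puts (x, y) in
the closed graph. -/
theorem mem_graph_of_hasDerivAt_zero (hA : IsSymm A) (h0 : V 0 = 1)
    (hV : ∀ t, HasGen V (fun ψ => Complex.I • A ψ) t) {x y : H}
    (hxy : HasDerivAt (fun τ => lift W (V τ) x) (Complex.I • y) 0) :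
    (x, y) ∈ (operator W A).graph := by
  have := completeSpace_of_unitary W
  have hdense : Dense ((LinearMap.range ((embed W) ∘ₗ (A.toLinearMap +
      Complex.I • LinearMap.id)) : Submodule ℂ H) : Set H) := by
    rw [Submodule.dense_iff_topologicalClosure_eq_top, Submodule.topologicalClosure_eq_top_iff,
      Submodule.eq_bot_iff]
    intro η hη
    have hη' : ∀ ψ, inner ℂ η (embed W (A ψ)) = -Complex.I * inner ℂ η (embed W ψ) := by
      intro ψ
      have := Submodule.inner_left_of_mem_orthogonal
        (LinearMap.mem_range_self ((embed W) ∘ₗ (A.toLinearMap + Complex.I • LinearMap.id)) ψ) hη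
      change inner ℂ η (embed W (A ψ + Complex.I • ψ)) = 0 at this
      rw [map_add, map_smul, inner_add_right, inner_smul_right] at this
      linear_combination this
    -- For η orthogonal to the range, f(τ) = ⟨η, V(τ)ψ⟩ satisfies f' = f. It grows like e^τ but is
    -- bounded by unitarity, so f(0) = 0 on letting τ tend to +∞.
    have hz : ∀ ψ, inner ℂ η (embed W ψ) = 0 := by
      intro ψ
      have hd : ∀ τ : ℝ, HasDerivAt (fun τ : ℝ => (Real.exp (-τ) : ℂ) * inner ℂ η (embed W (V τ ψ))) 0 τ := by
        intro τ
        have h1 : HasDerivAt (fun τ : ℝ => inner ℂ η (embed W (V τ ψ)))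
            (inner ℂ η (embed W (V τ ψ))) τ := by
          have := (hasDerivAt_const τ η).inner ℂ ((hV τ).embed (W := W) ψ)
          rw [map_smul, inner_smul_right, hη', inner_zero_left, add_zero, ← mul_assoc] at this
          simpa using this
        have h2 : HasDerivAt (fun τ : ℝ => (Real.exp (-τ) : ℂ)) (-(Real.exp (-τ) : ℂ)) τ := by
          have := ((hasDerivAt_neg τ).exp).ofReal_comp
          simpa using this
        have := h2.mul h1
        rw [neg_mul, neg_add_cancel] at this
        exact this
      have hc : ∀ τ : ℝ, inner ℂ η (embed W ψ) =
          (Real.exp (-τ) : ℂ) * inner ℂ η (embed W (V τ ψ)) := by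
        intro τ
        have := is_const_of_deriv_eq_zero (fun τ => (hd τ).differentiableAt) (fun τ => (hd τ).deriv) 0 τ
        simpa [h0] using this
      have hb : ∀ τ : ℝ, ‖inner ℂ η (embed W ψ)‖ ≤ Real.exp (-τ) * (‖η‖ * ‖embed W ψ‖) := by
        intro τ
        rw [hc τ, norm_mul, Complex.norm_real, Real.norm_eq_abs, Real.abs_exp]
        gcongr
        refine (norm_inner_le_norm _ _).trans (le_of_eq ?_)
        rw [norm_embed, SchwartzUnitary.norm_apply, norm_embed]
      have hl := (Real.tendsto_exp_neg_atTop_nhds_zero.mul_const (‖η‖ * ‖embed W ψ‖))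
      rw [zero_mul] at hl
      exact norm_le_zero_iff.1 (ge_of_tendsto' hl hb)
    exact inner_self_eq_zero.1 (eq_of_embed W (f := fun v : H => inner ℂ η v)
      (g := fun _ => (0 : ℂ)) (by fun_prop) (by fun_prop) hz η)
  -- Differentiating the constant ‖V(τ)p‖² at 0 gives Re⟨p, iq⟩ = 0, which is the vanishing of the
  -- cross term.
  have hpyth : ∀ p q : H, HasDerivAt (fun τ => lift W (V τ) p) (Complex.I • q) 0 →
      ‖q + Complex.I • p‖ ^ 2 = ‖q‖ ^ 2 + ‖p‖ ^ 2 := by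
    intro p q hd
    have h1 := hd.inner ℂ hd
    have h2 : (fun τ => inner ℂ (lift W (V τ) p) (lift W (V τ) p)) = fun _ => inner ℂ p p := by
      funext τ; rw [LinearIsometryEquiv.inner_map_map]
    rw [h2] at h1
    have h3 := h1.unique (hasDerivAt_const _ _)
    rw [h0, lift_one, LinearIsometryEquiv.coe_one, id] at h3
    have h4 : RCLike.re (inner ℂ p (Complex.I • q)) = 0 := by
      have := congrArg RCLike.re h3
      rw [map_add, inner_re_symm (Complex.I • q) p, map_zero] at this
      linarith
    rw [norm_add_sq (𝕜 := ℂ), norm_smul, Complex.norm_I, one_mul, inner_smul_right]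
    have h5 : RCLike.re (Complex.I * inner ℂ q p) = 0 := by
      have h6 : (inner ℂ q p).im = -(inner ℂ p q).im := inner_im_symm (𝕜 := ℂ) q p
      rw [inner_smul_right] at h4
      simp at h4 ⊢
      rw [h6, h4, neg_zero]
    rw [h5]
    ring
  refine (mem_graph_operator_iff hA _ _).2 (Metric.mem_closure_iff.2 fun ε hε => ?_)
  obtain ⟨_, ⟨ψ, rfl⟩, hψ⟩ := hdense.exists_dist_lt (y + Complex.I • x) hε
  refine ⟨_, ⟨ψ, rfl⟩, ?_⟩
  have h1 := hpyth (x - embed W ψ) (y - embed W (A ψ)) (by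
    have := hxy.sub (hasDerivAt_zero_of_mem_graph hA h0 hV (mem_graph_operator (W := W) hA ψ))
    rw [← smul_sub] at this
    exact this.congr_of_eventuallyEq (Filter.Eventually.of_forall fun τ => by simp))
  have h2 : y - embed W (A ψ) + Complex.I • (x - embed W ψ) =
      y + Complex.I • x - ((embed W) ∘ₗ (A.toLinearMap + Complex.I • LinearMap.id)) ψ := by
    simp [smul_sub]; abel
  rw [h2] at h1
  rw [dist_eq_norm] at hψ
  rw [Prod.dist_eq, max_lt_iff, dist_eq_norm, dist_eq_norm]
  have h3 := norm_nonneg (x - embed W ψ)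
  have h4 := norm_nonneg (y - embed W (A ψ))
  constructor
  · refine lt_of_le_of_lt (abs_le_of_sq_le_sq' ?_ (norm_nonneg _)).2 hψ
    nlinarith
  · refine lt_of_le_of_lt (abs_le_of_sq_le_sq' ?_ (norm_nonneg _)).2 hψ
    nlinarith

/-- A differentiable unitary group on the Schwartz space is the unitary group of the closure of
its generator. -/
theorem isUnitaryGroupOf_lift (hA : IsSymm A) (h0 : V 0 = 1)
    (hV : ∀ t, HasGen V (fun ψ => Complex.I • A ψ) t) :
    IsUnitaryGroupOf (operator W A) (fun τ => lift W (V τ)) where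
  zero := by rw [h0, lift_one]
  add := lift_add_of_hasGen hA h0 hV
  continuous φ := continuousOn_univ.1 (continuousOn_lift (W := W) (fun t _ => hV t) φ)
  generator _ _ := ⟨hasDerivAt_zero_of_mem_graph hA h0 hV, mem_graph_of_hasDerivAt_zero hA h0 hV⟩

/-- A group with this generator commutes with itself, so it preserves the domain of the generator.
Its orbits of Schwartz vectors therefore solve the evolution equation at all times, and
`solution_eq` applies. -/
theorem IsUnitaryGroupOf.eq_lift (hA : IsSymm A) (h0 : V 0 = 1)
    (hV : ∀ t, HasGen V (fun ψ => Complex.I • A ψ) t) {U : ℝ → H ≃ₗᵢ[ℂ] H}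
    (hU : IsUnitaryGroupOf (operator W A) U) : U = fun τ => lift W (V τ) := by
  funext t
  refine unitary_ext (W := W) fun ψ => ?_
  have h := solution_eq (W := W) (I := Set.univ) isOpen_univ Set.ordConnected_univ (z := Complex.I)
    (by simp) (A := fun _ => A) (fun _ => hA) (a := V) (fun t _ => hV t)
    (u := fun τ => U τ (embed W ψ)) (fun τ _ => ?_) (Set.mem_univ t) (Set.mem_univ 0)
  · simp only [h0, lift_one, hU.zero] at h
    simpa using h
  · have h1 := (hU.generator _ _).1 (mem_graph_operator (W := W) hA ψ)
    have h2 : HasDerivAt (fun σ => U τ (U σ (embed W ψ))) (U τ (Complex.I • embed W (A ψ))) 0 :=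
      ((U τ).toContinuousLinearEquiv.toContinuousLinearMap.hasFDerivAt.restrictScalars
        ℝ).comp_hasDerivAt 0 h1
    rw [map_smul] at h2
    refine ⟨U τ (embed W (A ψ)), (hU.generator _ _).2 ?_, ?_⟩
    · refine h2.congr_of_eventuallyEq (Filter.Eventually.of_forall fun σ => ?_)
      have : U σ * U τ = U τ * U σ := by rw [← hU.add, ← hU.add, add_comm]
      exact congrArg (fun X : H ≃ₗᵢ[ℂ] H => X (embed W ψ)) this
    · have h3 : HasDerivAt (fun σ => U (τ + σ) (embed W ψ))
          (Complex.I • U τ (embed W (A ψ))) 0 := by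
        refine h2.congr_of_eventuallyEq (Filter.Eventually.of_forall fun σ => ?_)
        simp only [hU.add, LinearIsometryEquiv.coe_mul, Function.comp_apply]
      have h4 := HasDerivAt.comp_sub_const (f := fun σ => U (τ + σ) (embed W ψ)) (x := τ) (a := τ)
        (by rw [sub_self]; exact h3)
      simpa using h4

theorem existsUnique_isUnitaryGroupOf (hA : IsSymm A) (h0 : V 0 = 1)
    (hV : ∀ t, HasGen V (fun ψ => Complex.I • A ψ) t) :
    ∃! U, IsUnitaryGroupOf (operator W A) U :=
  ⟨_, isUnitaryGroupOf_lift hA h0 hV, fun _ hU => hU.eq_lift hA h0 hV⟩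

/-- Existence makes the `Classical.epsilon` in `expI` meaningful, and uniqueness identifies the
chosen group. -/
theorem expI_eq_lift (hA : IsSymm A) (h0 : V 0 = 1)
    (hV : ∀ t, HasGen V (fun ψ => Complex.I • A ψ) t) (τ : ℝ) :
    expI (operator W A) τ = lift W (V τ) := by
  have h : IsUnitaryGroupOf (operator W A) (Classical.epsilon (IsUnitaryGroupOf (operator W A))) :=
    Classical.epsilon_spec ⟨_, isUnitaryGroupOf_lift hA h0 hV⟩
  exact congrFun (h.eq_lift hA h0 hV) τ

end Group

theorem sch_add_apply (φ ψ : Sch) (q : ℝ) : (φ + ψ) q = φ q + ψ q := rfl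

theorem sch_sub_apply (φ ψ : Sch) (q : ℝ) : (φ - ψ) q = φ q - ψ q := rfl

theorem sch_smul_apply (c : ℂ) (ψ : Sch) (q : ℝ) : (c • ψ) q = c * ψ q := rfl

/-! ### Norms -/

theorem norm_toL2_sq (ψ : Sch) : ‖toL2 ψ‖ ^ 2 = ∫ q, ‖ψ q‖ ^ 2 := by
  have h : ((‖toL2 ψ‖ ^ 2 : ℝ) : ℂ) = ((∫ q, ‖ψ q‖ ^ 2 : ℝ) : ℂ) := by
    rw [← integral_complex_ofReal, Complex.ofReal_pow]
    have := inner_self_eq_norm_sq_to_K (𝕜 := ℂ) (toL2 ψ)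
    rw [inner_toL2] at this
    refine this.symm.trans (integral_congr_ae (Filter.Eventually.of_forall fun q => ?_))
    simp only [Complex.ofReal_pow]
    exact inner_self_eq_norm_sq_to_K (𝕜 := ℂ) (ψ q)
  exact_mod_cast h

theorem norm_toL2_eq_of_integral {φ ψ : Sch} (h : ∫ q, ‖φ q‖ ^ 2 = ∫ q, ‖ψ q‖ ^ 2) :
    ‖toL2 φ‖ = ‖toL2 ψ‖ := by
  rw [← norm_toL2_sq, ← norm_toL2_sq] at h
  exact (pow_left_inj₀ (norm_nonneg _) (norm_nonneg _) two_ne_zero).1 h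

/-- The constant comes from (1 + q²)⁻² ≤ (1 + q²)⁻¹, whose integral is π. -/
theorem norm_toL2_le {ψ : Sch} {C : ℝ} (h : ∀ q, ‖ψ q‖ ≤ C / (1 + q ^ 2)) :
    ‖toL2 ψ‖ ≤ C * √Real.pi := by
  have hC : 0 ≤ C := by simpa using (norm_nonneg _).trans (h 0)
  refine abs_le_of_sq_le_sq' ?_ (by positivity) |>.2
  rw [norm_toL2_sq, mul_pow, Real.sq_sqrt Real.pi_pos.le, ← integral_univ_inv_one_add_sq,
    ← integral_const_mul]
  refine integral_mono_of_nonneg (Filter.Eventually.of_forall fun q => by positivity)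
    (integrable_inv_one_add_sq.const_mul _) (Filter.Eventually.of_forall fun q => ?_)
  have h1 : ‖ψ q‖ ^ 2 ≤ (C / (1 + q ^ 2)) ^ 2 := by gcongr; exact h q
  refine h1.trans ?_
  simp only [div_pow, ← div_eq_mul_inv]
  have : (1 : ℝ) ≤ 1 + q ^ 2 := by nlinarith [sq_nonneg q]
  gcongr
  nlinarith

theorem exists_norm_le_div (ψ : Sch) : ∃ C, ∀ q : ℝ, ‖ψ q‖ ≤ C / (1 + q ^ 2) := by
  obtain ⟨C₀, h₀⟩ := ψ.decay 0 0
  obtain ⟨C₂, h₂⟩ := ψ.decay 2 0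
  refine ⟨C₀ + C₂, fun q => ?_⟩
  rw [le_div_iff₀ (by positivity)]
  have e0 := h₀.2 q
  have e2 := h₂.2 q
  simp at e0 e2
  nlinarith

theorem exists_unit_norm_le_div (ψ : Sch) : ∃ C, 0 ≤ C ∧ ∀ q : ℝ, ‖ψ q‖ ≤ C / (1 + q ^ 2) := by
  obtain ⟨C, h⟩ := exists_norm_le_div ψ
  exact ⟨C, by simpa using (norm_nonneg _).trans (h 0), h⟩

/-! ### Differentiability of unitary groups on the Schwartz space -/

theorem norm_taylor_le {f f' f'' : ℝ → ℂ} {B : ℝ} (h1 : ∀ y, HasDerivAt f (f' y) y)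
    (h2 : ∀ y, HasDerivAt f' (f'' y) y) (hB : ∀ y, |y| ≤ 1 → ‖f'' y‖ ≤ B) {y : ℝ}
    (hy : |y| ≤ 1) : ‖f y - f 0 - y * f' 0‖ ≤ B * y ^ 2 := by
  have hseg : ∀ s ∈ Set.uIcc 0 y, |s| ≤ |y| := fun s hs => by
    simpa using Set.abs_sub_left_of_mem_uIcc hs
  have hB0 : 0 ≤ B := (norm_nonneg _).trans (hB 0 (by simp))
  have e1 : ∀ s ∈ Set.uIcc 0 y, ‖f' s - f' 0‖ ≤ B * |y| := by
    intro s hs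
    have := Convex.norm_image_sub_le_of_norm_hasDerivWithin_le (f := f') (f' := f'')
      (s := Set.uIcc 0 y) (C := B) (x := 0) (y := s) (fun x _ => (h2 x).hasDerivWithinAt)
      (fun x hx => hB x ((hseg x hx).trans hy)) (convex_uIcc _ _) Set.left_mem_uIcc hs
    refine this.trans ?_
    rw [sub_zero, Real.norm_eq_abs]
    exact mul_le_mul_of_nonneg_left (hseg s hs) hB0
  have e2 := Convex.norm_image_sub_le_of_norm_hasDerivWithin_le (f := fun s => f s - s * f' 0)
      (f' := fun s => f' s - f' 0) (s := Set.uIcc 0 y) (C := B * |y|) (x := 0) (y := y)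
      (fun x _ => by
        have := (h1 x).sub (((hasDerivAt_id x).ofReal_comp).mul_const (f' 0))
        simp only [Complex.ofReal_one, one_mul] at this
        exact this.hasDerivWithinAt)
      e1 (convex_uIcc _ _) Set.left_mem_uIcc Set.right_mem_uIcc
  simp only [Complex.ofReal_zero, zero_mul, sub_zero] at e2
  rw [Real.norm_eq_abs, mul_assoc, abs_mul_abs_self, ← pow_two] at e2
  rwa [sub_right_comm]

/-- The second derivative in the parameter is the family applied to G(Gψ). A bound on it by C/(1 +
q²), uniform for |y| ≤ 1, makes the Taylor remainder O(y²) in L². -/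
theorem hasGen_zero_of_pointwise {a : ℝ → SchwartzUnitary} {G : Sch → Sch} (h0 : a 0 = 1)
    (hd : ∀ ψ q y, HasDerivAt (fun y => a y ψ q) (a y (G ψ) q) y)
    (hb : ∀ ψ, ∃ C, ∀ y, |y| ≤ 1 → ∀ q, ‖a y ψ q‖ ≤ C / (1 + q ^ 2)) : HasGen a G 0 := by
  intro ψ
  rw [h0, SchwartzUnitary.one_apply]
  obtain ⟨C, hC⟩ := hb (G (G ψ))
  rw [hasDerivAt_iff_isLittleO]
  have h1 : (fun y => toL2 (a y ψ) - toL2 (a 0 ψ) - (y - 0) • toL2 (G ψ)) =O[nhds 0]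
      (fun y : ℝ => y ^ 2) := by
    refine Asymptotics.IsBigO.of_bound (C * √Real.pi) ?_
    filter_upwards [Metric.closedBall_mem_nhds (0 : ℝ) one_pos] with y hy
    have hy' : |y| ≤ 1 := by simpa using hy
    have e : toL2 (a y ψ) - toL2 (a 0 ψ) - (y - 0) • toL2 (G ψ) =
        toL2 (a y ψ - a 0 ψ - (y : ℂ) • G ψ) := by
      rw [map_sub, map_sub, map_smul, Complex.coe_smul, sub_zero]
      rfl
    rw [e]
    refine (norm_toL2_le (C := C * y ^ 2) fun q => ?_).trans (le_of_eq ?_)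
    · have := norm_taylor_le (f := fun y => a y ψ q) (hd ψ q) (hd (G ψ) q) (fun s hs => hC s hs q) hy'
      simp only [h0, SchwartzUnitary.one_apply] at this
      rw [h0, SchwartzUnitary.one_apply]
      refine this.trans (le_of_eq (by ring))
    · rw [Real.norm_eq_abs, abs_of_nonneg (sq_nonneg y)]
      ring
  refine h1.trans_isLittleO ?_
  simpa using Asymptotics.isLittleO_pow_id (𝕜 := ℝ) (n := 2) one_lt_two

theorem hasGen_of_group {a : ℝ → SchwartzUnitary} {G : Sch → Sch}
    (hadd : ∀ s t, a (s + t) = a s * a t) (h : HasGen a G 0) (t : ℝ) : HasGen a G t := by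
  have h1 : HasGen (fun τ => a (τ - t)) (fun ψ => ((1 : ℝ) : ℂ) • G ψ) t :=
    HasGen.comp (f := fun τ => τ - t) (by simpa using h) ((hasDerivAt_id t).sub_const t)
  refine ((h1.mul_const (a t)).congr (G' := G) fun ψ => by simp).congr_of_eventuallyEq
    (Filter.Eventually.of_forall fun τ => ?_)
  simp only
  rw [← hadd, sub_add_cancel]

/-- A unitary automorphism of the Schwartz space from a map and its inverse. -/
def SchwartzUnitary.mk' (f g : Sch →ₗ[ℂ] Sch) (hfg : ∀ ψ, f (g ψ) = ψ) (hgf : ∀ ψ, g (f ψ) = ψ)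
    (h : ∀ ψ, ‖toL2 (f ψ)‖ = ‖toL2 ψ‖) : SchwartzUnitary :=
  ⟨LinearEquiv.ofLinearMap f g (LinearMap.ext hfg) (LinearMap.ext hgf), h⟩

/-! ### Multiplication by a chirp -/

/-- All derivatives have modulus 1. Composition with a quadratic polynomial then makes every chirp a
multiplier of the Schwartz space. -/
theorem hasTemperateGrowth_cexp_I :
    (fun y : ℝ => Complex.exp (Complex.I * y)).HasTemperateGrowth := by
  have hd : ∀ n : ℕ, iteratedDeriv n (fun y : ℝ => Complex.exp (Complex.I * y)) =
      fun y : ℝ => Complex.I ^ n * Complex.exp (Complex.I * y) := by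
    intro n
    induction n with
    | zero => simp
    | succ n ih =>
      rw [iteratedDeriv_succ, ih]
      funext y
      have h : HasDerivAt (fun y : ℝ => Complex.exp (Complex.I * y))
          (Complex.exp (Complex.I * y) * Complex.I) y := by
        have := (((hasDerivAt_id y).ofReal_comp).const_mul Complex.I).cexp
        simpa using this
      rw [(h.const_mul _).deriv]
      ring
  refine ⟨(contDiff_const.mul Complex.ofRealCLM.contDiff).cexp, fun n => ⟨0, 1, fun y => ?_⟩⟩
  rw [norm_iteratedFDeriv_eq_norm_iteratedDeriv, hd]
  simp [Complex.norm_exp]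

/-- The phase `exp (i x q² / 2)`. -/
def chirpFun (x q : ℝ) : ℂ := Complex.exp (Complex.I * ((x / 2 * q ^ 2 : ℝ) : ℂ))

theorem chirpFun_hasTemperateGrowth (x : ℝ) : (chirpFun x).HasTemperateGrowth := by
  have h : (fun q : ℝ => x / 2 * q ^ 2).HasTemperateGrowth :=
    (Function.HasTemperateGrowth.const (x / 2)).mul (Function.HasTemperateGrowth.id'.pow 2)
  exact hasTemperateGrowth_cexp_I.comp h

theorem chirpFun_add (x y q : ℝ) : chirpFun (x + y) q = chirpFun x q * chirpFun y q := by
  rw [chirpFun, chirpFun, chirpFun, ← Complex.exp_add]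
  congr 1
  push_cast
  ring

theorem chirpFun_zero (q : ℝ) : chirpFun 0 q = 1 := by simp [chirpFun]

theorem norm_chirpFun (x q : ℝ) : ‖chirpFun x q‖ = 1 := by
  rw [chirpFun, mul_comm, Complex.norm_exp_ofReal_mul_I]

/-- Multiplication by the chirp `exp (i x q² / 2)`. -/
def chirp (x : ℝ) : SchwartzUnitary :=
  SchwartzUnitary.mk' (SchwartzMap.smulLeftCLM ℂ (chirpFun x)).toLinearMap
    (SchwartzMap.smulLeftCLM ℂ (chirpFun (-x))).toLinearMap
    (fun ψ => by
      ext q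
      simp only [ContinuousLinearMap.coe_coe,
        SchwartzMap.smulLeftCLM_apply_apply (chirpFun_hasTemperateGrowth _), smul_eq_mul]
      rw [← mul_assoc, ← chirpFun_add, add_neg_cancel, chirpFun_zero, one_mul])
    (fun ψ => by
      ext q
      simp only [ContinuousLinearMap.coe_coe,
        SchwartzMap.smulLeftCLM_apply_apply (chirpFun_hasTemperateGrowth _), smul_eq_mul]
      rw [← mul_assoc, ← chirpFun_add, neg_add_cancel, chirpFun_zero, one_mul])
    (fun ψ => norm_toL2_eq_of_integral (by
      simp only [ContinuousLinearMap.coe_coe, norm_smul, norm_chirpFun, one_mul,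
        SchwartzMap.smulLeftCLM_apply_apply (chirpFun_hasTemperateGrowth _)]))

theorem chirp_apply (x : ℝ) (ψ : Sch) (q : ℝ) : chirp x ψ q = chirpFun x q * ψ q :=
  SchwartzMap.smulLeftCLM_apply_apply (chirpFun_hasTemperateGrowth x) ψ q

theorem chirp_add (x y : ℝ) : chirp (x + y) = chirp x * chirp y :=
  SchwartzUnitary.ext fun ψ => by
    ext q
    simp only [SchwartzUnitary.mul_apply, chirp_apply, chirpFun_add, mul_assoc]

theorem chirp_zero : chirp 0 = 1 :=
  SchwartzUnitary.ext fun ψ => by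
    ext q
    simp only [SchwartzUnitary.one_apply, chirp_apply, chirpFun_zero, one_mul]

theorem hasDerivAt_chirpFun_left (x q : ℝ) :
    HasDerivAt (fun x => chirpFun x q) (chirpFun x q * (Complex.I * (q ^ 2 / 2))) x := by
  have := ((((hasDerivAt_id x).div_const 2).mul_const (q ^ 2)).ofReal_comp.const_mul
    Complex.I).cexp
  convert! this using 1
  simp only [chirpFun, id]
  push_cast
  ring

theorem hasDerivAt_chirpFun_right (x q : ℝ) :
    HasDerivAt (fun q => chirpFun x q) (chirpFun x q * (Complex.I * (x * q))) q := by
  have := (((hasDerivAt_pow 2 q).const_mul (x / 2)).ofReal_comp.const_mul Complex.I).cexp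
  convert! this using 1
  simp only [chirpFun]
  push_cast
  ring

theorem Q_chirp (x : ℝ) (ψ : Sch) : Q (chirp x ψ) = chirp x (Q ψ) := by
  ext q
  simp only [chirp_apply, Q_apply]
  ring

theorem P_chirp (x : ℝ) (ψ : Sch) : P (chirp x ψ) = chirp x (P ψ + (x : ℂ) • Q ψ) := by
  ext q
  have h : HasDerivAt (chirp x ψ) _ q :=
    ((hasDerivAt_chirpFun_right x q).mul (ψ.hasDerivAt q)).congr_of_eventuallyEq
      (Filter.Eventually.of_forall fun s => chirp_apply x ψ s)
  rw [P_apply, h.deriv, chirp_apply, sch_add_apply, sch_smul_apply, Q_apply, P_apply]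
  linear_combination (-x * q * chirpFun x q * ψ q) * Complex.I_sq

theorem hasGen_chirp (x : ℝ) : HasGen chirp (fun ψ => (Complex.I / 2) • Q (Q ψ)) x := by
  refine hasGen_of_group chirp_add (hasGen_zero_of_pointwise chirp_zero (fun ψ q y => ?_)
    fun ψ => ?_) x
  · simp only [chirp_apply, sch_smul_apply, Q_apply]
    convert! (hasDerivAt_chirpFun_left y q).mul_const (ψ q) using 1
    ring
  · obtain ⟨C, hC⟩ := exists_norm_le_div ψ
    refine ⟨C, fun y _ q => ?_⟩
    rw [chirp_apply, norm_mul, norm_chirpFun, one_mul]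
    exact hC q

/-! ### Dilations -/

/-- The dilation `q ↦ e^y q`. -/
def dilEquiv (y : ℝ) : ℝ ≃L[ℝ] ℝ :=
  ContinuousLinearEquiv.unitsEquivAut ℝ (Units.mk0 (Real.exp y) (Real.exp_pos y).ne')

/-- The unnormalized dilation of Schwartz functions. -/
def dilMap (y : ℝ) : Sch →ₗ[ℂ] Sch :=
  (Real.exp (y / 2) : ℂ) • (SchwartzMap.compCLMOfContinuousLinearEquiv ℂ (dilEquiv y)).toLinearMap

theorem dilMap_apply (y : ℝ) (ψ : Sch) (q : ℝ) :
    dilMap y ψ q = Real.exp (y / 2) * ψ (q * Real.exp y) := rfl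

theorem dilMap_dilMap_neg (y : ℝ) (ψ : Sch) : dilMap y (dilMap (-y) ψ) = ψ := by
  ext q
  simp only [dilMap_apply]
  rw [← mul_assoc, ← Complex.ofReal_mul, ← Real.exp_add, mul_assoc, ← Real.exp_add]
  simp [neg_div]

/-- The squeeze operator `(squeeze y ψ)(q) = e^{y/2} ψ(e^y q)`. -/
def squeeze (y : ℝ) : SchwartzUnitary :=
  SchwartzUnitary.mk' (dilMap y) (dilMap (-y)) (dilMap_dilMap_neg y)
    (fun ψ => by simpa using dilMap_dilMap_neg (-y) ψ)
    (fun ψ => norm_toL2_eq_of_integral (by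
      simp only [dilMap_apply, norm_mul, mul_pow, Complex.norm_real, Real.norm_eq_abs,
        Real.abs_exp]
      rw [integral_const_mul, Measure.integral_comp_mul_right (fun q => ‖ψ q‖ ^ 2), ← Real.exp_nat_mul,
        abs_of_pos (by positivity), smul_eq_mul, ← mul_assoc, ← Real.exp_neg, ← Real.exp_add]
      rw [show ((2 : ℕ) : ℝ) * (y / 2) + -y = 0 by push_cast; ring, Real.exp_zero, one_mul]))

theorem squeeze_apply (y : ℝ) (ψ : Sch) (q : ℝ) :
    squeeze y ψ q = Real.exp (y / 2) * ψ (q * Real.exp y) := rfl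

theorem squeeze_add (x y : ℝ) : squeeze (x + y) = squeeze x * squeeze y :=
  SchwartzUnitary.ext fun ψ => by
    ext q
    simp only [SchwartzUnitary.mul_apply, squeeze_apply, add_div, Real.exp_add, Complex.ofReal_mul,
      mul_assoc]

theorem squeeze_zero : squeeze 0 = 1 :=
  SchwartzUnitary.ext fun ψ => by
    ext q
    simp [squeeze_apply]

theorem Q_squeeze (y : ℝ) (ψ : Sch) :
    Q (squeeze y ψ) = squeeze y ((Real.exp (-y) : ℂ) • Q ψ) := by
  ext q
  have h : (Real.exp (-y) : ℂ) * Real.exp y = 1 := by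
    rw [← Complex.ofReal_mul, ← Real.exp_add]; simp
  rw [Q_apply, squeeze_apply, squeeze_apply, sch_smul_apply, Q_apply,
    Complex.ofReal_mul]
  linear_combination (-q * Real.exp (y / 2) * ψ (q * Real.exp y)) * h

theorem hasDerivAt_squeeze (y : ℝ) (ψ : Sch) (q : ℝ) :
    HasDerivAt (squeeze y ψ) (Real.exp (y / 2) * (Real.exp y * deriv ψ (q * Real.exp y))) q := by
  have h1 : HasDerivAt (fun q => ψ (q * Real.exp y)) (Real.exp y • deriv ψ (q * Real.exp y)) q := by
    have := (ψ.hasDerivAt (q * Real.exp y)).scomp q ((hasDerivAt_id q).mul_const (Real.exp y))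
    simpa [Function.comp_def] using this
  rw [← Complex.real_smul]
  exact h1.const_mul (Real.exp (y / 2) : ℂ)

theorem P_squeeze (y : ℝ) (ψ : Sch) :
    P (squeeze y ψ) = squeeze y ((Real.exp y : ℂ) • P ψ) := by
  ext q
  rw [P_apply, (hasDerivAt_squeeze y ψ q).deriv, squeeze_apply, sch_smul_apply, P_apply]
  ring

theorem QP_add_PQ_apply (ψ : Sch) (q : ℝ) :
    (Q (P ψ) + P (Q ψ)) q = -Complex.I * (2 * q * deriv ψ q + ψ q) := by
  have h : HasDerivAt (Q ψ) _ q :=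
    (((hasDerivAt_id q).ofReal_comp).mul (ψ.hasDerivAt q)).congr_of_eventuallyEq
      (Filter.Eventually.of_forall fun s => Q_apply ψ s)
  rw [sch_add_apply, Q_apply, P_apply, P_apply, h.deriv]
  simp
  ring

theorem hasGen_squeeze (y : ℝ) :
    HasGen squeeze (fun ψ => (Complex.I / 2) • (Q (P ψ) + P (Q ψ))) y := by
  refine hasGen_of_group squeeze_add (hasGen_zero_of_pointwise squeeze_zero (fun ψ q y => ?_)
    fun ψ => ?_) y
  · simp only [squeeze_apply, sch_smul_apply, QP_add_PQ_apply]
    have h1 : HasDerivAt (fun y => ψ (q * Real.exp y))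
        ((q * Real.exp y) • deriv ψ (q * Real.exp y)) y :=
      (ψ.hasDerivAt (q * Real.exp y)).scomp y ((Real.hasDerivAt_exp y).const_mul q)
    have h2 : HasDerivAt (fun y : ℝ => (Real.exp (y / 2) : ℂ)) ((Real.exp (y / 2) / 2 : ℝ) : ℂ) y := by
      have := (((hasDerivAt_id y).div_const 2).exp).ofReal_comp
      simpa [div_eq_mul_inv] using this
    convert! h2.mul h1 using 1
    rw [Complex.real_smul]
    push_cast
    linear_combination (-(1 / 2) * Complex.exp (y / 2) * (2 * (q * Complex.exp y) *
      deriv ψ (q * Real.exp y) + ψ (q * Real.exp y))) * Complex.I_sq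
  · obtain ⟨C, hC0, hC⟩ := exists_unit_norm_le_div ψ
    -- For |y| ≤ 1 the prefactor e^{y/2} is at most e, and 1 + q² ≤ e²(1 + q²e^{2y}).
    refine ⟨Real.exp 1 * (C * Real.exp 2), fun y hy q => ?_⟩
    obtain ⟨hy1, hy2⟩ := abs_le.1 hy
    rw [squeeze_apply, norm_mul, Complex.norm_real, Real.norm_eq_abs, Real.abs_exp, mul_div_assoc]
    have h1 : Real.exp (y / 2) ≤ Real.exp 1 := Real.exp_le_exp.2 (by linarith)
    refine mul_le_mul h1 ((hC _).trans ?_) (norm_nonneg _) (Real.exp_pos _).le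
    rw [div_le_div_iff₀ (by positivity) (by positivity), mul_assoc]
    refine mul_le_mul_of_nonneg_left ?_ hC0
    have h2 : (1 : ℝ) ≤ Real.exp 2 := Real.one_le_exp (by norm_num)
    have h3 : 1 ≤ Real.exp 2 * Real.exp y ^ 2 := by
      rw [← Real.exp_nat_mul, ← Real.exp_add]
      exact Real.one_le_exp (by push_cast; linarith)
    nlinarith [sq_nonneg q, mul_le_mul_of_nonneg_left h3 (sq_nonneg q)]

/-! ### Symmetric operators -/

theorem isSymm_Q : IsSymm Q := by
  intro φ ψ
  rw [inner_toL2, inner_toL2]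
  refine integral_congr_ae (Filter.Eventually.of_forall fun q => ?_)
  simp [Q_apply]
  ring

/-- Complex conjugation of a Schwartz function. -/
def conjSch (φ : Sch) : Sch :=
  SchwartzMap.postcompCLM (Complex.conjCLE.toContinuousLinearMap : ℂ →L[ℝ] ℂ) φ

theorem conjSch_apply (φ : Sch) (q : ℝ) : conjSch φ q = (starRingEnd ℂ) (φ q) := rfl

theorem deriv_conjSch (φ : Sch) (q : ℝ) :
    deriv (conjSch φ) q = (starRingEnd ℂ) (deriv φ q) := by
  have h : HasDerivAt (conjSch φ) _ q :=
    Complex.conjCLE.toContinuousLinearMap.hasFDerivAt.comp_hasDerivAt q (φ.hasDerivAt q)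
  exact h.deriv

theorem isSymm_P : IsSymm P := by
  intro φ ψ
  rw [inner_toL2, inner_toL2]
  have h := SchwartzMap.integral_mul_deriv_eq_neg_deriv_mul (𝕜 := ℂ) (conjSch φ) ψ
  simp only [conjSch_apply, deriv_conjSch] at h
  calc ∫ x, inner ℂ (φ x) (P ψ x)
      = ∫ x, -Complex.I * ((starRingEnd ℂ) (φ x) * deriv ψ x) := by
        refine integral_congr_ae (Filter.Eventually.of_forall fun q => ?_)
        simp [P_apply]
        ring
    _ = ∫ x, Complex.I * ((starRingEnd ℂ) (deriv φ x) * ψ x) := by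
        rw [integral_const_mul, h, integral_const_mul]
        ring
    _ = _ := by
        refine integral_congr_ae (Filter.Eventually.of_forall fun q => ?_)
        simp [P_apply]
        ring

theorem IsSymm.comp_comm {A B : Sch → Sch} (hA : IsSymm A) (hB : IsSymm B) (φ ψ : Sch) :
    inner ℂ (toL2 φ) (toL2 (A (B ψ))) = inner ℂ (toL2 (B (A φ))) (toL2 ψ) := by
  rw [hA, hB]

theorem IsSymm.add {A B : Sch → Sch} (hA : IsSymm A) (hB : IsSymm B) :
    IsSymm (fun ψ => A ψ + B ψ) := fun φ ψ => by
  rw [map_add, map_add, inner_add_left, inner_add_right, hA, hB]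

theorem IsSymm.real_smul {A : Sch → Sch} (hA : IsSymm A) (r : ℝ) :
    IsSymm (fun ψ => (r : ℂ) • A ψ) := fun φ ψ => by
  rw [map_smul, map_smul, inner_smul_left, inner_smul_right, hA, Complex.conj_ofReal]

theorem isSymm_QQ : IsSymm (Q ∘L Q) := isSymm_Q.comp_comm isSymm_Q

theorem isSymm_PP : IsSymm (P ∘L P) := isSymm_P.comp_comm isSymm_P

theorem isSymm_QP_add_PQ : IsSymm ⇑(Q ∘L P + P ∘L Q) := fun φ ψ => by
  change inner ℂ (toL2 φ) (toL2 (Q (P ψ) + P (Q ψ))) = inner ℂ (toL2 (Q (P φ) + P (Q φ))) (toL2 ψ)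
  rw [map_add, map_add, inner_add_left, inner_add_right, isSymm_Q.comp_comm isSymm_P, isSymm_P.comp_comm isSymm_Q, add_comm]

theorem isSymm_PP_add_QQ : IsSymm ⇑(P ∘L P + Q ∘L Q) := isSymm_PP.add isSymm_QQ

theorem isSymm_hamiltonian (k : ℝ) :
    IsSymm ⇑((1 / 2 : ℂ) • (P ∘L P + (k : ℂ) • (Q ∘L Q))) := by
  have h := (isSymm_PP.add (isSymm_QQ.real_smul k)).real_smul (1 / 2)
  have e : ((1 / 2 : ℝ) : ℂ) = 1 / 2 := by push_cast; rfl
  rw [e] at h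
  exact h

/-! ### The Fourier transform -/

/-- The Fourier transform with kernel `exp (-2πi q v)`. -/
def fourierU : SchwartzUnitary :=
  ⟨(fourierCLE ℂ Sch).toLinearEquiv, fun ψ => SchwartzMap.norm_fourier_toL2_eq ψ⟩

theorem fourierU_apply (ψ : Sch) : fourierU ψ = 𝓕 ψ := rfl

theorem fourierU_apply_apply (ψ : Sch) (q : ℝ) :
    fourierU ψ q = ∫ v : ℝ, Complex.exp (((-2 * Real.pi * v * q : ℝ) : ℂ) * Complex.I) * ψ v :=
  Real.fourier_real_eq_integral_exp_smul ψ q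

theorem fourierU_fourierU (ψ : Sch) (q : ℝ) : fourierU (fourierU ψ) q = ψ (-q) := by
  have h : 𝓕⁻ (𝓕 ψ) = ψ := fourierInv_fourier_eq ψ
  rw [SchwartzMap.fourierInv_apply_eq] at h
  conv_rhs => rw [← h]
  rw [SchwartzMap.compCLMOfContinuousLinearEquiv_apply]
  simp [fourierU_apply]

theorem fourierU_mul_squeeze (y : ℝ) : fourierU * squeeze y = squeeze (-y) * fourierU :=
  SchwartzUnitary.ext fun ψ => by
    ext q
    rw [SchwartzUnitary.mul_apply, SchwartzUnitary.mul_apply, squeeze_apply, fourierU_apply_apply,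
      fourierU_apply_apply]
    have h := Measure.integral_comp_mul_right (fun v : ℝ =>
      Complex.exp (((-2 * Real.pi * v * (q * Real.exp (-y)) : ℝ) : ℂ) * Complex.I) * ψ v)
      (Real.exp y)
    rw [abs_of_pos (by positivity), ← Real.exp_neg, Complex.real_smul] at h
    have e : (Real.exp (y / 2) : ℂ) * Real.exp (-y) = Real.exp (-y / 2) := by
      rw [← Complex.ofReal_mul, ← Real.exp_add]
      congr 2
      ring
    rw [← e, mul_assoc, ← h, ← integral_const_mul]
    refine integral_congr_ae (Filter.Eventually.of_forall fun v => ?_)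
    simp only [squeeze_apply]
    have e2 : -2 * Real.pi * (v * Real.exp y) * (q * Real.exp (-y)) = -2 * Real.pi * v * q := by
      have : Real.exp y * Real.exp (-y) = 1 := by rw [← Real.exp_add]; simp
      linear_combination (-2 * Real.pi * v * q) * this
    rw [e2]
    ring

/-- The Fourier transform with kernel `(2π)^(-1/2) exp (-i q v)`. -/
def fourierN : SchwartzUnitary := squeeze (-Real.log (2 * Real.pi)) * fourierU

theorem fourierN_apply (ψ : Sch) (q : ℝ) :
    fourierN ψ q = ((√(2 * Real.pi))⁻¹ : ℝ) *
      ∫ v : ℝ, Complex.exp (((-(v * q) : ℝ) : ℂ) * Complex.I) * ψ v := by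
  have hpi : (0 : ℝ) < 2 * Real.pi := by positivity
  rw [fourierN, SchwartzUnitary.mul_apply, squeeze_apply, fourierU_apply_apply, Real.exp_neg,
    Real.exp_log hpi]
  congr 2
  · rw [← Real.sqrt_inv, Real.sqrt_eq_rpow, Real.rpow_def_of_pos (by positivity), Real.log_inv]
    congr 1
    ring
  · funext v
    congr 4
    field_simp

theorem fourierN_fourierN (ψ : Sch) (q : ℝ) : fourierN (fourierN ψ) q = ψ (-q) := by
  have h : fourierN * fourierN = fourierU * fourierU := by
    rw [fourierN, mul_assoc, ← mul_assoc fourierU, fourierU_mul_squeeze, neg_neg, mul_assoc,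
      ← mul_assoc, ← squeeze_add, neg_add_cancel, squeeze_zero, one_mul]
  have h2 := congrArg (fun a : SchwartzUnitary => a ψ q) h
  exact h2.trans (fourierU_fourierU ψ q)

theorem fourierU_P (ψ : Sch) : fourierU (P ψ) = ((2 * Real.pi : ℝ) : ℂ) • Q (fourierU ψ) := by
  ext q
  have h : 𝓕 (deriv ψ) q = (2 * Real.pi * Complex.I * q) • 𝓕 (ψ : ℝ → ℂ) q := by
    rw [Real.fourier_deriv ψ.integrable ψ.differentiable
      (SchwartzMap.derivCLM ℂ ℂ ψ).integrable]
  have e : fourierU (P ψ) q = -Complex.I * 𝓕 (deriv ψ) q := by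
    rw [fourierU_apply_apply, Real.fourier_real_eq_integral_exp_smul, ← integral_const_mul]
    refine integral_congr_ae (Filter.Eventually.of_forall fun v => ?_)
    simp only [P_apply, smul_eq_mul]
    ring
  rw [e, h, sch_smul_apply, Q_apply, fourierU_apply, SchwartzMap.fourier_coe, smul_eq_mul]
  push_cast
  linear_combination (-2 * Real.pi * q * 𝓕 (ψ : ℝ → ℂ) q) * Complex.I_sq

/-- The dilation in `fourierN` absorbs the 2π of the Fourier transform. This relation makes the free
evolution a conjugated chirp. -/
theorem Q_fourierN (ψ : Sch) : Q (fourierN ψ) = fourierN (P ψ) := by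
  have hpi : (0 : ℝ) < 2 * Real.pi := by positivity
  rw [fourierN, SchwartzUnitary.mul_apply, SchwartzUnitary.mul_apply, Q_squeeze, fourierU_P,
    neg_neg, Real.exp_log hpi]

/-- The free evolution `exp (-i z P² / 2)`. -/
def free (z : ℝ) : SchwartzUnitary := fourierN⁻¹ * (chirp (-z) * fourierN)

theorem hasGen_free (z : ℝ) : HasGen free (fun ψ => (-(Complex.I / 2)) • P (P ψ)) z := by
  have h1 : HasGen (fun z => chirp (-z)) (fun ψ => ((-1 : ℝ) : ℂ) • (Complex.I / 2) • Q (Q ψ)) z :=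
    HasGen.comp (f := fun z => -z) (hasGen_chirp (-z)) (hasDerivAt_neg z)
  refine ((h1.mul_const fourierN).const_mul fourierN⁻¹).congr fun ψ => ?_
  rw [inv_inv, Q_fourierN, Q_fourierN, smul_smul]
  change fourierN⁻¹.1 (_ • fourierN (P (P ψ))) = _
  rw [map_smul]
  change _ • fourierN⁻¹ (fourierN (P (P ψ))) = _
  rw [SchwartzUnitary.inv_apply_self]
  congr 1
  push_cast
  ring

theorem free_zero : free 0 = 1 := by
  rw [free, neg_zero, chirp_zero, one_mul, inv_mul_cancel]

/-! ### Oscillator families -/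

theorem SchwartzUnitary.map_smul (a : SchwartzUnitary) (c : ℂ) (ψ : Sch) :
    a (c • ψ) = c • a ψ := _root_.map_smul a.1 c ψ

theorem SchwartzUnitary.map_add (a : SchwartzUnitary) (φ ψ : Sch) :
    a (φ + ψ) = a φ + a ψ := _root_.map_add a.1 φ ψ

theorem chirp_Q (x : ℝ) (ψ : Sch) : chirp x (Q ψ) = Q (chirp x ψ) := (Q_chirp x ψ).symm

theorem chirp_P (x : ℝ) (ψ : Sch) :
    chirp x (P ψ) = P (chirp x ψ) - (x : ℂ) • Q (chirp x ψ) := by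
  rw [P_chirp, SchwartzUnitary.map_add, SchwartzUnitary.map_smul, chirp_Q, add_sub_cancel_right]

theorem squeeze_Q (y : ℝ) (ψ : Sch) :
    squeeze y (Q ψ) = (Real.exp y : ℂ) • Q (squeeze y ψ) := by
  rw [Q_squeeze, SchwartzUnitary.map_smul, smul_smul, ← Complex.ofReal_mul, ← Real.exp_add,
    add_neg_cancel, Real.exp_zero, Complex.ofReal_one, one_smul]

theorem squeeze_P (y : ℝ) (ψ : Sch) :
    squeeze y (P ψ) = (Real.exp (-y) : ℂ) • P (squeeze y ψ) := by
  rw [P_squeeze, SchwartzUnitary.map_smul, smul_smul, ← Complex.ofReal_mul, ← Real.exp_add,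
    neg_add_cancel, Real.exp_zero, Complex.ofReal_one, one_smul]

/-- A chirp and a dilation that solve the Riccati equation turn the equation of a (free or harmonic)
family with rescaled time into that of an oscillator. -/
theorem hasGen_chirp_mul_squeeze_mul {a b : ℝ → ℝ} {a' b' t α β k : ℝ} {B : ℝ → SchwartzUnitary}
    (ha : HasDerivAt a a' t) (hb : HasDerivAt b b' t)
    (hB : HasGen B (fun ψ => (-(Complex.I / 2)) • ((α : ℂ) • P (P ψ) + (β : ℂ) • Q (Q ψ))) t)
    (h1 : α * Real.exp (-b t) ^ 2 = 1) (h2 : b' = -a t)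
    (h3 : k = β * Real.exp (b t) ^ 2 - a' - a t ^ 2) :
    HasGen (fun τ => chirp (a τ) * (squeeze (b τ) * B τ))
      (fun ψ => (-Complex.I) • ((1 / 2 : ℂ) • (P (P ψ) + (k : ℂ) • Q (Q ψ)))) t := by
  refine (((hasGen_chirp (a t)).comp ha).mul
    (((hasGen_squeeze (b t)).comp hb).mul hB)).congr fun ψ => ?_
  have h1' : (α : ℂ) * (Real.exp (-b t) : ℂ) ^ 2 = 1 := by exact_mod_cast h1
  have h3' : (k : ℂ) = β * (Real.exp (b t) : ℂ) ^ 2 - a' - (a t : ℂ) ^ 2 := by exact_mod_cast h3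
  have hc : chirp (a t) ((chirp (a t))⁻¹ ψ) = ψ := SchwartzUnitary.apply_inv_self _ _
  have hs : squeeze (b t) ((squeeze (b t))⁻¹ ((chirp (a t))⁻¹ ψ)) = (chirp (a t))⁻¹ ψ :=
    SchwartzUnitary.apply_inv_self _ _
  -- Conjugation by the dilation scales P by e^{-b} and Q by e^{b}; conjugation by the chirp
  -- replaces P by P - aQ. Then `h1` normalizes the P² term, `h2` cancels the mixed terms PQ + QP,
  -- and `h3` identifies the coefficient of Q².
  simp only [SchwartzUnitary.map_add, chirp_Q, chirp_P, squeeze_Q,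
    squeeze_P, hs, hc, map_sub, map_smul, h2, smul_add, smul_sub, smul_smul]
  ext q
  simp only [sch_add_apply, sch_smul_apply, sch_sub_apply]
  rw [h3', Complex.ofReal_neg]
  linear_combination (-(Complex.I / 2) * (P (P ψ) q - a t * P (Q ψ) q - a t * Q (P ψ) q +
    a t ^ 2 * Q (Q ψ) q)) * h1'

/-! ### The Fresnel integral -/

theorem fourierN_inv_apply (ψ : Sch) (q : ℝ) : fourierN⁻¹ ψ q = fourierN ψ (-q) := by
  have h := fourierN_fourierN (fourierN⁻¹ ψ) (-q)
  rw [SchwartzUnitary.apply_inv_self, neg_neg] at h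
  exact h.symm

/-- With Re b > 0 the double integral obtained by inserting the Fourier integral converges
absolutely. Fubini leaves a Gaussian integral in v. The oscillatory case Re b = 0 is reached only as
a limit. -/
theorem integral_gaussian_fourierN {b : ℂ} (hb : 0 < b.re) (ψ : Sch) (q : ℝ) :
    ∫ v : ℝ, Complex.exp (-(b / 2) * v ^ 2 + Complex.I * q * v) * fourierN ψ v =
      ((√(2 * Real.pi))⁻¹ : ℝ) * (2 * Real.pi / b) ^ (1 / 2 : ℂ) *
        ∫ x : ℝ, Complex.exp (-(q - x) ^ 2 / (2 * b)) * ψ x := by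
  have hb2 : (-(b / 2)).re < 0 := by
    rw [Complex.neg_re, Complex.div_ofNat_re]; linarith
  have hgi : ∀ x : ℝ, Integrable fun v : ℝ =>
      Complex.exp (-(b / 2) * v ^ 2 + Complex.I * x * v) := fun x => by
    simpa using integrable_cexp_quadratic' hb2 (Complex.I * x) 0
  have hg : ∀ x : ℝ, ∫ v : ℝ, Complex.exp (-(b / 2) * v ^ 2 + Complex.I * (q - x : ℝ) * v) =
      (2 * Real.pi / b) ^ (1 / 2 : ℂ) * Complex.exp (-(q - x) ^ 2 / (2 * b)) := by
    intro x
    have h := integral_cexp_quadratic hb2 (Complex.I * (q - x : ℝ)) 0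
    simp only [add_zero, neg_neg, zero_sub] at h
    have hb0 : b ≠ 0 := fun h0 => by simp [h0] at hb
    rw [h]
    congr 2
    · field_simp
    · rw [mul_pow, Complex.I_sq]
      push_cast
      field_simp
      ring
  have hswap := integral_integral_swap (μ := (volume : Measure ℝ)) (ν := (volume : Measure ℝ))
    (f := fun v x : ℝ => Complex.exp (-(b / 2) * v ^ 2 + Complex.I * (q - x : ℝ) * v) * ψ x) (by
      refine ((hgi q).mul_prod (ψ.integrable (μ := volume))).mono ?_ (Eventually.of_forall ?_)
      · refine Continuous.aestronglyMeasurable ?_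
        have : Continuous ψ := ψ.continuous
        simp only [Function.uncurry_def]
        fun_prop
      · rintro ⟨v, x⟩
        simp only [Function.uncurry_apply_pair, norm_mul]
        refine le_of_eq ?_
        congr 1
        rw [Complex.norm_exp, Complex.norm_exp]
        congr 1
        simp)
  calc _ = ∫ v : ℝ, ((√(2 * Real.pi))⁻¹ : ℝ) * ∫ x : ℝ,
        Complex.exp (-(b / 2) * v ^ 2 + Complex.I * (q - x : ℝ) * v) * ψ x := by
        refine integral_congr_ae (Eventually.of_forall fun v => ?_)
        simp only [fourierN_apply]
        rw [mul_left_comm, ← integral_const_mul]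
        congr 2
        funext x
        rw [← mul_assoc, ← Complex.exp_add]
        congr 2
        push_cast
        ring
    _ = _ := by
        rw [integral_const_mul, hswap, mul_assoc]
        congr 1
        rw [← integral_const_mul]
        refine integral_congr_ae (Eventually.of_forall fun x => ?_)
        simp only [integral_mul_const, hg]
        ring

/-- The principal branch at -i fixes the phase exp(-iπ/4) of the Fresnel integral. -/
theorem cpow_half_of_neg_I {r : ℝ} (hr : 0 < r) :
    ((r : ℂ) * -Complex.I) ^ (1 / 2 : ℂ) =
      (√r : ℝ) * Complex.exp (-(Real.pi / 4 * Complex.I)) := by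
  have hI : -Complex.I ≠ 0 := by simp
  have hr' : (r : ℂ) ≠ 0 := by exact_mod_cast hr.ne'
  rw [Complex.cpow_def_of_ne_zero (mul_ne_zero hr' hI), Complex.log_ofReal_mul hr hI,
    Complex.log_neg_I, Real.sqrt_eq_rpow, Real.rpow_def_of_pos hr, Complex.ofReal_exp,
    ← Complex.exp_add]
  congr 1
  push_cast
  ring

theorem continuous_cexp_mul_sch {f : ℝ → ℂ} (hf : Continuous f) (ψ : Sch) :
    Continuous fun v => Complex.exp (f v) * ψ v := by
  have : Continuous ψ := ψ.continuous
  fun_prop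

/-- The kernel of the free evolution. -/
theorem free_apply {z : ℝ} (hz : 0 < z) (ψ : Sch) (q : ℝ) :
    free z ψ q = Complex.exp (-(Real.pi / 4 * Complex.I)) * ((√(2 * Real.pi * z))⁻¹ : ℝ) *
      ∫ x : ℝ, Complex.exp ((((q - x) ^ 2 / (2 * z) : ℝ) : ℂ) * Complex.I) * ψ x := by
  have hpi : (0 : ℝ) < 2 * Real.pi := by positivity
  have hz' : (z : ℂ) ≠ 0 := by exact_mod_cast hz.ne'
  have e0 : free z ψ q = ((√(2 * Real.pi))⁻¹ : ℝ) *
      ∫ v : ℝ, Complex.exp (-((0 + Complex.I * z) / 2) * v ^ 2 + Complex.I * q * v) *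
        fourierN ψ v := by
    rw [free, SchwartzUnitary.mul_apply, SchwartzUnitary.mul_apply, fourierN_inv_apply,
      fourierN_apply]
    congr 2
    funext v
    rw [chirp_apply, chirpFun, ← mul_assoc, ← Complex.exp_add]
    congr 2
    push_cast
    ring
  -- A damping ε > 0 is added to iz and then removed: both sides of the Gaussian identity converge
  -- as ε → 0⁺ by dominated convergence.
  have hl : Tendsto (fun ε : ℝ =>
      ∫ v : ℝ, Complex.exp (-(((ε : ℂ) + Complex.I * z) / 2) * v ^ 2 + Complex.I * q * v) *
        fourierN ψ v) (𝓝[>] 0)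
      (𝓝 (∫ v : ℝ, Complex.exp (-((0 + Complex.I * z) / 2) * v ^ 2 + Complex.I * q * v) *
        fourierN ψ v)) := by
    refine tendsto_integral_filter_of_dominated_convergence (fun v => ‖fourierN ψ v‖)
      (Eventually.of_forall fun ε => (continuous_cexp_mul_sch (by fun_prop) _).aestronglyMeasurable)
      ?_ (SchwartzMap.integrable _).norm (Eventually.of_forall fun v => ?_)
    · filter_upwards [self_mem_nhdsWithin] with ε hε
      refine Eventually.of_forall fun v => ?_
      rw [norm_mul, Complex.norm_exp]
      refine mul_le_of_le_one_left (norm_nonneg _) (Real.exp_le_one_iff.2 ?_)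
      have hε' : 0 < ε := hε
      have : ((-(((ε : ℂ) + Complex.I * z) / 2) * v ^ 2 + Complex.I * q * v)).re =
          -(ε / 2 * v ^ 2) := by
        simp [pow_two]
      rw [this]
      have : 0 ≤ ε / 2 * v ^ 2 := by positivity
      linarith
    · refine tendsto_nhdsWithin_of_tendsto_nhds ?_
      refine Continuous.tendsto' (by fun_prop) _ _ (by simp)
  have hr : Tendsto (fun ε : ℝ => ((√(2 * Real.pi))⁻¹ : ℝ) *
      (2 * Real.pi / ((ε : ℂ) + Complex.I * z)) ^ (1 / 2 : ℂ) *
        ∫ x : ℝ, Complex.exp (-(q - x) ^ 2 / (2 * ((ε : ℂ) + Complex.I * z))) * ψ x) (𝓝[>] 0)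
      (𝓝 (((√(2 * Real.pi))⁻¹ : ℝ) * (2 * Real.pi / (0 + Complex.I * z)) ^ (1 / 2 : ℂ) *
        ∫ x : ℝ, Complex.exp (-(q - x) ^ 2 / (2 * (0 + Complex.I * z))) * ψ x)) := by
    have hne : (0 + Complex.I * z) ≠ 0 := by simp [hz']
    have hε : Tendsto (fun ε : ℝ => (ε : ℂ) + Complex.I * z) (𝓝[>] 0) (𝓝 (0 + Complex.I * z)) :=
      tendsto_nhdsWithin_of_tendsto_nhds (Continuous.tendsto' (by fun_prop) _ _ (by simp))
    refine Tendsto.mul (tendsto_const_nhds.mul ?_) ?_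
    -- The limit 2π/(iz) lies on the negative imaginary axis, away from the branch cut of the square
    -- root.
    · refine (continuousAt_cpow_const ?_).tendsto.comp (tendsto_const_nhds.div hε hne)
      right
      have : (2 * (Real.pi : ℂ) / (0 + Complex.I * z)) = ((-(2 * Real.pi / z) : ℝ) : ℂ) * Complex.I := by
        push_cast
        field_simp
        simp
        linear_combination (z : ℂ) * Complex.I_sq
      rw [this]
      have : 0 < 2 * Real.pi / z := by positivity
      simp [hz.ne', Real.pi_ne_zero]
    · refine tendsto_integral_filter_of_dominated_convergence (fun v => ‖ψ v‖)
        (Eventually.of_forall fun ε => (continuous_cexp_mul_sch (by fun_prop) _).aestronglyMeasurable)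
        ?_ (SchwartzMap.integrable _).norm (Eventually.of_forall fun v => ?_)
      · filter_upwards [self_mem_nhdsWithin] with ε hε
        refine Eventually.of_forall fun x => ?_
        rw [norm_mul, Complex.norm_exp]
        refine mul_le_of_le_one_left (norm_nonneg _) (Real.exp_le_one_iff.2 ?_)
        have hε' : 0 < ε := hε
        have : (-((q : ℂ) - x) ^ 2 / (2 * ((ε : ℂ) + Complex.I * z))) =
            ((-(q - x) ^ 2 / 2 : ℝ) : ℂ) * ((ε : ℂ) + Complex.I * z)⁻¹ := by
          push_cast
          rw [div_mul_eq_div_div, div_eq_mul_inv (_ / _)]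
        rw [this, Complex.re_ofReal_mul, Complex.inv_re]
        have h1 : 0 ≤ ((ε : ℂ) + Complex.I * z).re / Complex.normSq ((ε : ℂ) + Complex.I * z) := by
          refine div_nonneg ?_ (Complex.normSq_nonneg _)
          simpa using hε'.le
        nlinarith [mul_nonneg (sq_nonneg (q - x)) h1]
      · refine Tendsto.mul_const _ (Complex.continuous_exp.continuousAt.tendsto.comp
          (tendsto_const_nhds.div (tendsto_const_nhds.mul hε) (mul_ne_zero two_ne_zero hne)))
  have heq := tendsto_nhds_unique (hl.congr' (by
    filter_upwards [self_mem_nhdsWithin] with ε hε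
    exact integral_gaussian_fourierN (b := (ε : ℂ) + Complex.I * z) (by simpa using hε) ψ q)) hr
  rw [e0, heq]
  have e1 : (2 * (Real.pi : ℂ) / (0 + Complex.I * z)) = ((2 * Real.pi / z : ℝ) : ℂ) * -Complex.I := by
    push_cast
    field_simp
    simp
    linear_combination (z : ℂ) * Complex.I_sq
  rw [e1, cpow_half_of_neg_I (by positivity)]
  have e2 : √(2 * Real.pi) * √(2 * Real.pi) = 2 * Real.pi := Real.mul_self_sqrt hpi.le
  have e3 : (√(2 * Real.pi))⁻¹ * ((√(2 * Real.pi))⁻¹ * √(2 * Real.pi / z)) =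
      (√(2 * Real.pi * z))⁻¹ := by
    rw [Real.sqrt_div hpi.le, Real.sqrt_mul hpi.le]
    have : 0 < √(2 * Real.pi) := by positivity
    field_simp
  rw [← e3]
  have e4 : ∀ x : ℝ, -((q : ℂ) - x) ^ 2 / (2 * (0 + Complex.I * z)) =
      (((q - x) ^ 2 / (2 * z) : ℝ) : ℂ) * Complex.I := by
    intro x
    push_cast
    field_simp
    simp
    linear_combination (-((q : ℂ) - x) ^ 2 * z) * Complex.I_sq
  simp only [e4]
  push_cast
  ring

/-! ### Phases and parity -/

/-- Multiplication by the phase `exp (i x)`. -/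
def phase (x : ℝ) : SchwartzUnitary :=
  SchwartzUnitary.mk' (Complex.exp (x * Complex.I) • LinearMap.id)
    (Complex.exp (-(x * Complex.I)) • LinearMap.id)
    (fun ψ => by simp [smul_smul, ← Complex.exp_add])
    (fun ψ => by simp [smul_smul, ← Complex.exp_add])
    (fun ψ => by
      simp only [LinearMap.smul_apply, LinearMap.id_apply, map_smul, norm_smul,
        Complex.norm_exp_ofReal_mul_I, one_mul])

theorem phase_apply (x : ℝ) (ψ : Sch) (q : ℝ) :
    phase x ψ q = Complex.exp (x * Complex.I) * ψ q := rfl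

theorem phase_apply' (x : ℝ) (ψ : Sch) :
    phase x ψ = Complex.exp (x * Complex.I) • ψ := rfl

theorem mul_phase (a : SchwartzUnitary) (x : ℝ) : a * phase x = phase x * a :=
  SchwartzUnitary.ext fun ψ => by
    rw [SchwartzUnitary.mul_apply, SchwartzUnitary.mul_apply, phase_apply', phase_apply',
      SchwartzUnitary.map_smul]

/-- The rotation by the angle `π / 2`. -/
def quarterTurn : SchwartzUnitary := phase (-(Real.pi / 4)) * fourierN

/-- Two Fourier transforms give parity and the two phases multiply to exp(-iπ/2). Each half turn
thus contributes a factor -i. -/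
theorem quarterTurn_sq_apply (ψ : Sch) (q : ℝ) :
    (quarterTurn * quarterTurn) ψ q = -Complex.I * ψ (-q) := by
  have h : quarterTurn * quarterTurn =
      phase (-(Real.pi / 4)) * (phase (-(Real.pi / 4)) * (fourierN * fourierN)) := by
    rw [quarterTurn, mul_assoc, ← mul_assoc fourierN, mul_phase, mul_assoc]
  rw [h, SchwartzUnitary.mul_apply, SchwartzUnitary.mul_apply, phase_apply, phase_apply,
    SchwartzUnitary.mul_apply, fourierN_fourierN, ← mul_assoc, ← Complex.exp_add]
  congr 1
  rw [← Complex.exp_neg_pi_div_two_mul_I]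
  congr 1
  push_cast
  ring

theorem quarterTurn_sq_zpow_apply (j : ℤ) (ψ : Sch) (q : ℝ) :
    ((quarterTurn * quarterTurn) ^ j) ψ q = (-Complex.I) ^ j * ψ ((-1) ^ j * q) := by
  have hI : -Complex.I ≠ 0 := by simp
  have hinv : ∀ (ψ : Sch) (q : ℝ),
      (quarterTurn * quarterTurn)⁻¹ ψ q = (-Complex.I)⁻¹ * ψ (-q) := by
    intro ψ q
    have := quarterTurn_sq_apply ((quarterTurn * quarterTurn)⁻¹ ψ) (-q)
    rw [SchwartzUnitary.apply_inv_self, neg_neg] at this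
    rw [this, ← mul_assoc, inv_mul_cancel₀ hI, one_mul]
  induction j using Int.induction_on generalizing ψ q with
  | zero => simp
  | succ j ih =>
    rw [zpow_add_one, SchwartzUnitary.mul_apply, ih, quarterTurn_sq_apply, zpow_add_one₀ hI,
      zpow_add_one₀ (by norm_num)]
    rw [mul_assoc]
    congr 3
    ring
  | pred j ih =>
    rw [zpow_sub_one, SchwartzUnitary.mul_apply, ih, hinv, zpow_sub_one₀ hI,
      zpow_sub_one₀ (by norm_num)]
    rw [mul_assoc]
    congr 3
    norm_num

/-! ### The rotation group -/

/-- The phase of the Mehler kernel. -/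
def mehlerFun (c s q v : ℝ) : ℂ :=
  Complex.exp ((((c * (q ^ 2 + v ^ 2) - 2 * q * v) / (2 * s) : ℝ) : ℂ) * Complex.I)

/-- The rotation by an angle `|θ| < π / 2`. -/
def rotChart (θ : ℝ) : SchwartzUnitary :=
  chirp (-Real.tan θ) * (squeeze (-Real.log (Real.cos θ)) * free (Real.tan θ))

theorem rotChart_zero : rotChart 0 = 1 := by
  simp [rotChart, chirp_zero, squeeze_zero, free_zero]

theorem exp_neg_log_div_two {r : ℝ} (hr : 0 < r) : Real.exp (-Real.log r / 2) = (√r)⁻¹ := by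
  rw [← Real.sqrt_inv, Real.sqrt_eq_rpow, Real.rpow_def_of_pos (by positivity), Real.log_inv]
  congr 1
  ring

theorem exp_neg_pi_div_four :
    Complex.exp ((-(Real.pi / 4) : ℝ) * Complex.I) =
      Complex.exp (-(Real.pi / 4 * Complex.I)) := by
  push_cast
  rw [neg_mul]

/-- A chirp is even, so it commutes with parity, the square of `fourierN`. -/
theorem free_neg_mul_fourierN (y : ℝ) : free (-y) * fourierN = fourierN * chirp y := by
  have hcomm : fourierN * fourierN * chirp y = chirp y * (fourierN * fourierN) :=
    SchwartzUnitary.ext fun ψ => by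
      ext q
      simp only [SchwartzUnitary.mul_apply, fourierN_fourierN, chirp_apply]
      simp [chirpFun]
  rw [free, neg_neg, mul_assoc, mul_assoc, ← hcomm, mul_assoc, inv_mul_cancel_left]

/-- The kernel of the rotation by an angle in `(0, π)`. -/
theorem rotChart_mul_quarterTurn_apply {θ : ℝ} (h : 0 < Real.sin θ) (ψ : Sch) (q : ℝ) :
    (rotChart (θ - Real.pi / 2) * quarterTurn) ψ q =
      Complex.exp (-(Real.pi / 4 * Complex.I)) * ((√(2 * Real.pi * Real.sin θ))⁻¹ : ℝ) *
        ∫ v : ℝ, mehlerFun (Real.cos θ) (Real.sin θ) q v * ψ v := by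
  have hpi : (0 : ℝ) < 2 * Real.pi := by positivity
  have ht : Real.tan (θ - Real.pi / 2) = -(Real.cos θ / Real.sin θ) := by
    rw [Real.tan_eq_sin_div_cos, Real.sin_sub_pi_div_two, Real.cos_sub_pi_div_two, neg_div]
  set cot := Real.cos θ / Real.sin θ with hcot
  -- Since tan(θ - π/2) = -cot θ, the free factor can be moved through the Fourier transform and
  -- becomes a chirp. No Fresnel integral remains, and the kernel is valid on all of sin θ > 0.
  have e : rotChart (θ - Real.pi / 2) * quarterTurn =
      phase (-(Real.pi / 4)) * (chirp cot * (squeeze (-Real.log (Real.sin θ)) *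
        (fourierN * chirp cot))) := by
    rw [rotChart, ht, neg_neg, Real.cos_sub_pi_div_two, quarterTurn, ← mul_assoc (chirp _ * _),
      mul_phase, ← free_neg_mul_fourierN]
    simp only [mul_assoc]
  rw [e]
  simp only [SchwartzUnitary.mul_apply, phase_apply, chirp_apply, squeeze_apply, fourierN_apply]
  rw [exp_neg_log_div_two h, Real.exp_neg, Real.exp_log h, exp_neg_pi_div_four, mul_assoc]
  congr 1
  have e2 : (√(2 * Real.pi * Real.sin θ))⁻¹ = (√(Real.sin θ))⁻¹ * (√(2 * Real.pi))⁻¹ := by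
    rw [Real.sqrt_mul hpi.le, mul_inv, mul_comm]
  have e3 : ∀ A B C D : ℂ, A * (B * (C * D)) = B * C * (A * D) := fun A B C D => by ring
  rw [e2, Complex.ofReal_mul, e3]
  congr 1
  rw [← integral_const_mul]
  refine integral_congr_ae (Eventually.of_forall fun v => ?_)
  simp only [chirpFun, mehlerFun]
  rw [← mul_assoc, ← mul_assoc, ← Complex.exp_add, ← Complex.exp_add]
  congr 2
  have : (Real.sin θ : ℂ) ≠ 0 := by exact_mod_cast h.ne'
  rw [hcot]
  push_cast
  field_simp
  ring

/-- The kernel of the rotation by an angle in `(0, π / 2)`. -/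
theorem rotChart_apply {θ : ℝ} (hs : 0 < Real.sin θ) (hc : 0 < Real.cos θ) (ψ : Sch) (q : ℝ) :
    rotChart θ ψ q =
      Complex.exp (-(Real.pi / 4 * Complex.I)) * ((√(2 * Real.pi * Real.sin θ))⁻¹ : ℝ) *
        ∫ v : ℝ, mehlerFun (Real.cos θ) (Real.sin θ) q v * ψ v := by
  have hpi : (0 : ℝ) < 2 * Real.pi := by positivity
  have ht : Real.tan θ = Real.sin θ / Real.cos θ := Real.tan_eq_sin_div_cos θ
  have htp : 0 < Real.tan θ := by rw [ht]; positivity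
  simp only [rotChart, SchwartzUnitary.mul_apply, chirp_apply, squeeze_apply, free_apply htp]
  rw [exp_neg_log_div_two hc, Real.exp_neg, Real.exp_log hc]
  have e2 : (√(2 * Real.pi * Real.sin θ))⁻¹ =
      (√(Real.cos θ))⁻¹ * (√(2 * Real.pi * Real.tan θ))⁻¹ := by
    rw [ht, ← mul_inv, ← Real.sqrt_mul hc.le]
    congr 2
    field_simp
  have e3 : ∀ A B C D E : ℂ, A * (B * (C * D * E)) = C * (B * D) * (A * E) :=
    fun A B C D E => by ring
  rw [e2, Complex.ofReal_mul, e3]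
  congr 1
  rw [← integral_const_mul]
  refine integral_congr_ae (Eventually.of_forall fun v => ?_)
  simp only [chirpFun, mehlerFun]
  rw [← mul_assoc, ← Complex.exp_add, mul_comm Complex.I, ← add_mul, ← Complex.ofReal_add]
  congr 5
  rw [ht]
  have hsc := Real.sin_sq_add_cos_sq θ
  field_simp
  have hsc' : Real.sin θ ^ 2 = 1 - Real.cos θ ^ 2 := by linarith
  rw [hsc']
  ring

/-- Neighbouring charts agree where they overlap because both have the Mehler kernel there,
including the phase exp(-iπ/4). -/
theorem rotChart_eq {θ : ℝ} (hs : 0 < Real.sin θ) (hc : 0 < Real.cos θ) :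
    rotChart θ = rotChart (θ - Real.pi / 2) * quarterTurn :=
  SchwartzUnitary.ext fun ψ => by
    ext q
    rw [rotChart_apply hs hc, rotChart_mul_quarterTurn_apply hs]

/-- The chirp -tan θ, the scale 1/cos θ and the free time tan θ satisfy the Riccati equation with κ
= 1, by sec² - tan² = 1. -/
theorem hasGen_rotChart {θ : ℝ} (h : 0 < Real.cos θ) :
    HasGen rotChart
      (fun ψ => (-Complex.I) • ((1 / 2 : ℂ) • (P (P ψ) + ((1 : ℝ) : ℂ) • Q (Q ψ)))) θ := by
  have ht := Real.hasDerivAt_tan h.ne'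
  have hl : HasDerivAt (fun θ => -Real.log (Real.cos θ)) (-(-Real.sin θ / Real.cos θ)) θ :=
    ((Real.hasDerivAt_cos θ).log h.ne').neg
  refine hasGen_chirp_mul_squeeze_mul (α := 1 / Real.cos θ ^ 2) (β := 0) ht.neg hl
    ((HasGen.comp (f := Real.tan) (hasGen_free _) ht).congr fun ψ => ?_) ?_ ?_ ?_
  · rw [Complex.ofReal_zero, zero_smul, add_zero, smul_comm]
  · rw [neg_neg, Real.exp_log h]
    field_simp
  · rw [neg_neg, Real.tan_eq_sin_div_cos, neg_div, neg_neg]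
  · rw [Real.tan_eq_sin_div_cos]
    have := Real.sin_sq_add_cos_sq θ
    field_simp
    linarith

/-- The rotation by `θ`, in the chart around `k π / 2`. -/
def rotAt (k : ℤ) (θ : ℝ) : SchwartzUnitary :=
  rotChart (θ - k * (Real.pi / 2)) * quarterTurn ^ k

theorem rotAt_succ {k : ℤ} {θ : ℝ} (h1 : k * (Real.pi / 2) < θ)
    (h2 : θ < (k + 1 : ℤ) * (Real.pi / 2)) : rotAt (k + 1) θ = rotAt k θ := by
  push_cast at h2
  have h3 : 0 < θ - k * (Real.pi / 2) := by linarith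
  have h4 : θ - k * (Real.pi / 2) < Real.pi / 2 := by linarith
  rw [rotAt, rotAt, rotChart_eq (Real.sin_pos_of_pos_of_lt_pi h3 (by linarith))
    (Real.cos_pos_of_mem_Ioo ⟨by linarith, h4⟩), add_comm k 1, zpow_one_add, mul_assoc]
  congr 2
  push_cast
  ring

/-- The rotation `exp (-i θ (P² + Q²) / 2)`. -/
def rot (θ : ℝ) : SchwartzUnitary := rotAt (round (θ / (Real.pi / 2))) θ

theorem rot_eq_rotAt {k : ℤ} {θ : ℝ} (h : |θ - k * (Real.pi / 2)| < Real.pi / 2) :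
    rot θ = rotAt k θ := by
  have hpi : 0 < Real.pi / 2 := by positivity
  set x := θ / (Real.pi / 2) with hx
  have hθ : θ = x * (Real.pi / 2) := by rw [hx]; field_simp
  have h1 : |x - k| < 1 := by
    rw [hθ, ← sub_mul, abs_mul, abs_of_pos hpi] at h
    exact lt_of_mul_lt_mul_right (by linarith) hpi.le
  have h2 := abs_sub_round x
  rw [rot, ← hx]
  set r := round x with hr
  obtain ⟨h3, h4⟩ := abs_lt.1 h1
  obtain ⟨h5, h6⟩ := abs_le.1 h2
  have h7 : r < k + 2 := by
    have : (r : ℝ) < k + 2 := by linarith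
    exact_mod_cast this
  have h8 : k - 2 < r := by
    have : (k : ℝ) - 2 < r := by linarith
    exact_mod_cast this
  -- The nearest chart and any admissible one differ by at most one step, so one overlap relation
  -- suffices.
  have h9 : r = k ∨ r = k + 1 ∨ k = r + 1 := by omega
  rcases h9 with h9 | h9 | h9
  · rw [h9]
  · rw [h9]
    have : (r : ℝ) = k + 1 := by exact_mod_cast h9
    apply rotAt_succ
    · rw [hθ]; exact mul_lt_mul_of_pos_right (by linarith) hpi
    · rw [hθ]; push_cast; exact mul_lt_mul_of_pos_right (by linarith) hpi
  · rw [h9]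
    have : (k : ℝ) = r + 1 := by exact_mod_cast h9
    refine (rotAt_succ ?_ ?_).symm
    · rw [hθ]; exact mul_lt_mul_of_pos_right (by linarith) hpi
    · rw [hθ]; push_cast; exact mul_lt_mul_of_pos_right (by linarith) hpi

theorem rot_zero : rot 0 = 1 := by
  rw [rot_eq_rotAt (k := 0) (by simp [Real.pi_pos]), rotAt]
  simp [rotChart_zero]

/-- The chart selected by `round` may jump, but one fixed chart represents `rot` in a neighbourhood
of θ. -/
theorem hasGen_rot (θ : ℝ) :
    HasGen rot (fun ψ => (-(Complex.I / 2)) • (P (P ψ) + Q (Q ψ))) θ := by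
  set k := round (θ / (Real.pi / 2)) with hk
  have hpi : 0 < Real.pi / 2 := by positivity
  have h1 : |θ - k * (Real.pi / 2)| < Real.pi / 2 := by
    have h2 := abs_sub_round (θ / (Real.pi / 2))
    have e : θ - k * (Real.pi / 2) = (θ / (Real.pi / 2) - k) * (Real.pi / 2) := by
      field_simp
    rw [e, abs_mul, abs_of_pos hpi, hk]
    nlinarith
  have h2 : HasGen (rotAt k) _ θ := (HasGen.comp (f := fun θ => θ - k * (Real.pi / 2))
    (hasGen_rotChart (Real.cos_pos_of_mem_Ioo (abs_lt.1 h1)))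
    ((hasDerivAt_id θ).sub_const _)).mul_const (quarterTurn ^ k)
  refine (h2.congr fun ψ => ?_).congr_of_eventuallyEq ?_
  · simp only [Complex.ofReal_one, one_smul, smul_smul]
    congr 1
    ring
  · have : ∀ᶠ τ in 𝓝 θ, |τ - k * (Real.pi / 2)| < Real.pi / 2 :=
      (by fun_prop : Continuous fun τ : ℝ => |τ - k * (Real.pi / 2)|).continuousAt.eventually_lt
        continuousAt_const h1
    exact this.mono fun τ hτ => rot_eq_rotAt hτ

theorem rot_int_mul_pi_apply (j : ℤ) (ψ : Sch) (q : ℝ) :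
    rot (j * Real.pi) ψ q = (-Complex.I) ^ j * ψ ((-1) ^ j * q) := by
  have e : j * Real.pi - (2 * j : ℤ) * (Real.pi / 2) = 0 := by push_cast; ring
  rw [rot_eq_rotAt (k := 2 * j) (by rw [e]; simp [Real.pi_pos]), rotAt, e, rotChart_zero, one_mul,
    zpow_mul, zpow_ofNat, pow_two, quarterTurn_sq_zpow_apply]

/-- The Mehler formula, with the Maslov phase. -/
theorem rot_apply {θ : ℝ} (h : Real.sin θ ≠ 0) (ψ : Sch) (q : ℝ) :
    rot θ ψ q = Complex.exp (-(Real.pi / 4 * Complex.I)) * (-Complex.I) ^ ⌊θ / Real.pi⌋ *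
      ((√(2 * Real.pi * |Real.sin θ|))⁻¹ : ℝ) *
        ∫ v : ℝ, mehlerFun (Real.cos θ) (Real.sin θ) q v * ψ v := by
  set j := ⌊θ / Real.pi⌋ with hj
  have hpi := Real.pi_pos
  have h1 : j * Real.pi ≤ θ := by
    rw [← le_div_iff₀ hpi]; exact Int.floor_le _
  have h2 : θ < (j + 1) * Real.pi := by
    rw [← div_lt_iff₀ hpi]; exact Int.lt_floor_add_one _
  have h1' : j * Real.pi ≠ θ := fun e => h (by rw [← e]; exact Real.sin_int_mul_pi j)
  have h1'' : j * Real.pi < θ := lt_of_le_of_ne h1 h1'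
  set θ' := θ - j * Real.pi with hθ'
  have hs' : Real.sin θ' = (-1) ^ j * Real.sin θ := Real.sin_sub_int_mul_pi θ j
  have hc' : Real.cos θ' = (-1) ^ j * Real.cos θ := Real.cos_sub_int_mul_pi θ j
  have hsp : 0 < Real.sin θ' := Real.sin_pos_of_pos_of_lt_pi (by linarith) (by linarith)
  have hone : ((-1 : ℝ) ^ j) * (-1) ^ j = 1 := by
    rw [← mul_zpow]; norm_num
  have habs : |Real.sin θ| = Real.sin θ' := by
    rw [← abs_of_pos hsp, hs', abs_mul, abs_zpow]
    simp
  have e : θ - (2 * j + 1 : ℤ) * (Real.pi / 2) = θ' - Real.pi / 2 := by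
    rw [hθ']; push_cast; ring
  -- The odd chart centred at jπ + π/2 covers the whole interval between the caustics jπ and (j+1)π.
  -- Its quarter turns split into one, which produces the kernel at θ', and j half turns, which
  -- produce (-i)^j and parity.
  rw [rot_eq_rotAt (k := 2 * j + 1) (by rw [e, abs_lt]; constructor <;> linarith), rotAt, e,
    add_comm (2 * j) 1, zpow_one_add, zpow_mul, zpow_ofNat, pow_two, ← mul_assoc,
    SchwartzUnitary.mul_apply, rotChart_mul_quarterTurn_apply hsp, habs]
  have hint : ∫ v : ℝ, mehlerFun (Real.cos θ') (Real.sin θ') q v *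
      ((quarterTurn * quarterTurn) ^ j) ψ v =
      (-Complex.I) ^ j * ∫ v : ℝ, mehlerFun (Real.cos θ) (Real.sin θ) q v * ψ v := by
    have e1 : ∀ v, mehlerFun (Real.cos θ') (Real.sin θ') q v *
        ((quarterTurn * quarterTurn) ^ j) ψ v = (-Complex.I) ^ j *
        (mehlerFun (Real.cos θ) (Real.sin θ) q ((-1) ^ j * v) * ψ ((-1) ^ j * v)) := by
      intro v
      -- Passing from θ' to θ multiplies sine and cosine by (-1)^j. This leaves the quadratic terms
      -- unchanged and flips the cross term, as v ↦ (-1)^j v does.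
      have e2 : mehlerFun (Real.cos θ') (Real.sin θ') q v =
          mehlerFun (Real.cos θ) (Real.sin θ) q ((-1) ^ j * v) := by
        unfold mehlerFun
        congr 3
        rw [hs', hc']
        have hne : ((-1 : ℝ) ^ j) ≠ 0 := zpow_ne_zero _ (by norm_num)
        rw [div_eq_div_iff (by positivity) (by positivity)]
        generalize (-1 : ℝ) ^ j = σ at hone
        linear_combination (2 * Real.sin θ * σ * Real.cos θ * v ^ 2 * (-1)
          + 2 * Real.sin θ * (-2 * q * v)*(-1)) * hone
      rw [quarterTurn_sq_zpow_apply, e2]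
      ring
    simp only [e1]
    rw [integral_const_mul]
    congr 1
    rcases Int.even_or_odd j with hev | hod
    · simp [hev.neg_one_zpow]
    · simp only [hod.neg_one_zpow, neg_one_mul]
      exact integral_neg_eq_self (fun v => mehlerFun (Real.cos θ) (Real.sin θ) q v * ψ v) _
  rw [hint]
  ring

/-! ### Existence for the oscillator equation -/

theorem exists_Icc_subset {I : Set ℝ} (hI : IsOpen I) (hI' : I.OrdConnected) {x y : ℝ}
    (hx : x ∈ I) (hy : y ∈ I) :
    ∃ a b, x ∈ Set.Ioo a b ∧ y ∈ Set.Ioo a b ∧ Set.Icc a b ⊆ I := by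
  have hmin : min x y ∈ I := by rcases min_choice x y with h | h <;> rwa [h]
  have hmax : max x y ∈ I := by rcases max_choice x y with h | h <;> rwa [h]
  obtain ⟨ε, hε, h1⟩ := Metric.isOpen_iff.1 hI _ hmin
  obtain ⟨δ, hδ, h2⟩ := Metric.isOpen_iff.1 hI _ hmax
  have ha : min x y - ε / 2 ∈ I := h1 (by
    rw [Metric.mem_ball, Real.dist_eq, sub_sub_cancel_left, abs_neg, abs_of_pos (by positivity)]
    linarith)
  have hb : max x y + δ / 2 ∈ I := h2 (by
    rw [Metric.mem_ball, Real.dist_eq, add_sub_cancel_left, abs_of_pos (by positivity)]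
    linarith)
  refine ⟨_, _, ⟨?_, ?_⟩, ⟨?_, ?_⟩, hI'.out ha hb⟩
  · linarith [min_le_left x y]
  · linarith [le_max_left x y]
  · linarith [min_le_right x y]
  · linarith [le_max_right x y]

theorem hasDerivAt_integral_of_continuousOn {I : Set ℝ} (hI : IsOpen I) (hI' : I.OrdConnected)
    {g : ℝ → ℝ} (hg : ContinuousOn g I) {t₀ t : ℝ} (ht₀ : t₀ ∈ I) (ht : t ∈ I) :
    HasDerivAt (fun t => ∫ τ in t₀..t, g τ) (g t) t :=
  intervalIntegral.integral_hasDerivAt_right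
    (hg.mono (hI'.uIcc_subset ht₀ ht)).intervalIntegrable
    (hg.stronglyMeasurableAtFilter hI t ht) (hg.continuousAt (hI.mem_nhds ht))

/-- The vector field of the Prüfer angle. -/
def pruferField (k x : ℝ) : ℝ := -(Real.sin x ^ 2 + k * Real.cos x ^ 2)

theorem lipschitzWith_pruferField {k : ℝ} {M : NNReal} (hk : |k| ≤ M) :
    LipschitzWith (2 * (1 + M)) (pruferField k) := by
  have hd : ∀ x, HasDerivAt (pruferField k)
      (-(2 * Real.sin x * Real.cos x + k * (2 * Real.cos x * -Real.sin x))) x := by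
    intro x
    have := (((Real.hasDerivAt_sin x).pow 2).add
      (((Real.hasDerivAt_cos x).pow 2).const_mul k)).neg
    convert! this using 1
    simp
  refine lipschitzWith_of_nnnorm_deriv_le (fun x => (hd x).differentiableAt) fun x => ?_
  rw [(hd x).deriv, ← NNReal.coe_le_coe, coe_nnnorm, norm_neg, Real.norm_eq_abs]
  have e : 2 * Real.sin x * Real.cos x + k * (2 * Real.cos x * -Real.sin x) =
      2 * ((1 - k) * (Real.sin x * Real.cos x)) := by ring
  rw [e, abs_mul, abs_mul, abs_mul, abs_two]
  push_cast
  have h1 : |1 - k| ≤ 1 + M := (abs_sub _ _).trans (by rw [abs_one]; linarith)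
  have h2 : |Real.sin x| * |Real.cos x| ≤ 1 :=
    mul_le_one₀ (Real.abs_sin_le_one x) (abs_nonneg _) (Real.abs_cos_le_one x)
  have h3 : |1 - k| * (|Real.sin x| * |Real.cos x|) ≤ (1 + M) * 1 :=
    mul_le_mul h1 h2 (by positivity) (by positivity)
  linarith

theorem abs_pruferField_le {k : ℝ} {M : NNReal} (hk : |k| ≤ M) (x : ℝ) :
    |pruferField k x| ≤ 1 + M := by
  rw [pruferField, abs_neg]
  have h1 := Real.sin_sq_le_one x
  have h2 := Real.cos_sq_le_one x
  refine (abs_add_le _ _).trans (add_le_add ?_ ?_)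
  · rwa [abs_of_nonneg (sq_nonneg _)]
  · rw [abs_mul, abs_of_nonneg (sq_nonneg (Real.cos x))]
    calc |k| * Real.cos x ^ 2 ≤ M * 1 := mul_le_mul hk h2 (sq_nonneg _) M.2
      _ = M := mul_one _

/-- The Prüfer field is bounded and globally Lipschitz in the angle. A ball of radius (bound) · (b -
a) therefore contains the solution on the whole interval, and a single application of
Picard–Lindelöf suffices. -/
theorem exists_prufer_Ioo {κ : ℝ → ℝ} {a b : ℝ} (hκ : ContinuousOn κ (Set.Icc a b)) {t₀ : ℝ}
    (ht₀ : t₀ ∈ Set.Ioo a b) (φ₀ : ℝ) :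
    ∃ φ : ℝ → ℝ, φ t₀ = φ₀ ∧ ∀ t ∈ Set.Ioo a b, HasDerivAt φ (pruferField (κ t) (φ t)) t := by
  obtain ⟨M, hM⟩ := isCompact_Icc.exists_bound_of_continuousOn hκ
  have hM' : ∀ t ∈ Set.Icc a b, |κ t| ≤ M.toNNReal := fun t ht =>
    (hM t ht).trans (Real.le_coe_toNNReal M)
  have hab : a ≤ b := (ht₀.1.trans ht₀.2).le
  have hPL : IsPicardLindelof (fun t x => pruferField (κ t) x)
      (⟨t₀, Set.Ioo_subset_Icc_self ht₀⟩ : Set.Icc a b) φ₀ ((1 + M.toNNReal) * (b - a).toNNReal) 0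
      (1 + M.toNNReal) (2 * (1 + M.toNNReal)) := by
    refine ⟨fun t ht => (lipschitzWith_pruferField (hM' t ht)).lipschitzOnWith, fun x _ => ?_,
      fun t ht x _ => ?_, ?_⟩
    · unfold pruferField
      fun_prop
    · rw [Real.norm_eq_abs]
      exact_mod_cast abs_pruferField_le (hM' t ht) x
    · push_cast
      rw [sub_zero, Real.coe_toNNReal (b - a) (by linarith)]
      refine mul_le_mul_of_nonneg_left (max_le ?_ ?_) (by positivity)
      · linarith [ht₀.1]
      · linarith [ht₀.2]
  obtain ⟨φ, h0, h⟩ := hPL.exists_eq_forall_mem_Icc_hasDerivWithinAt₀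
  exact ⟨φ, h0, fun t ht =>
    (h t (Set.Ioo_subset_Icc_self ht)).hasDerivAt (Icc_mem_nhds ht.1 ht.2)⟩

theorem exists_prufer {I : Set ℝ} (hI : IsOpen I) (hI' : I.OrdConnected) {κ : ℝ → ℝ}
    (hκ : ContinuousOn κ I) {t₀ : ℝ} (ht₀ : t₀ ∈ I) (φ₀ : ℝ) :
    ∃ φ : ℝ → ℝ, φ t₀ = φ₀ ∧ ∀ t ∈ I, HasDerivAt φ (pruferField (κ t) (φ t)) t := by
  have hex : ∀ t : ℝ, ∃ (φ : ℝ → ℝ) (a b : ℝ), t ∈ I → t ∈ Set.Ioo a b ∧ t₀ ∈ Set.Ioo a b ∧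
      Set.Icc a b ⊆ I ∧ φ t₀ = φ₀ ∧
      ∀ s ∈ Set.Ioo a b, HasDerivAt φ (pruferField (κ s) (φ s)) s := by
    intro t
    by_cases ht : t ∈ I
    · obtain ⟨a, b, h1, h2, h3⟩ := exists_Icc_subset hI hI' ht ht₀
      obtain ⟨φ, h4, h5⟩ := exists_prufer_Ioo (hκ.mono h3) h2 φ₀
      exact ⟨φ, a, b, fun _ => ⟨h1, h2, h3, h4, h5⟩⟩
    · exact ⟨0, 0, 0, fun h => absurd h ht⟩
  choose φ a b h using hex
  have hun : ∀ t ∈ I, ∀ s ∈ Set.Ioo (a t) (b t), s ∈ I → φ s s = φ t s := by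
    intro t ht s hs hsI
    obtain ⟨h1, h2, h3, h4, h5⟩ := h t ht
    obtain ⟨k1, k2, k3, k4, k5⟩ := h s hsI
    obtain ⟨M, hM⟩ := isCompact_Icc.exists_bound_of_continuousOn (hκ.mono h3)
    have hsub : Set.Ioo (max (a t) (a s)) (min (b t) (b s)) ⊆
        Set.Ioo (a t) (b t) ∩ Set.Ioo (a s) (b s) := by
      rw [Set.Ioo_inter_Ioo]
    refine (ODE_solution_unique_of_mem_Ioo (v := fun t x => pruferField (κ t) x)
      (s := fun _ => Set.univ) (K := 2 * (1 + M.toNNReal))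
      (a := max (a t) (a s)) (b := min (b t) (b s)) (t₀ := t₀) (fun r hr => ?_)
      ⟨max_lt h2.1 k2.1, lt_min h2.2 k2.2⟩ (fun r hr => ⟨k5 r (hsub hr).2, trivial⟩)
      (fun r hr => ⟨h5 r (hsub hr).1, trivial⟩) (k4.trans h4.symm))
      ⟨max_lt hs.1 k1.1, lt_min hs.2 k1.2⟩
    exact (lipschitzWith_pruferField ((hM r (Set.Ioo_subset_Icc_self (hsub hr).1)).trans
      (Real.le_coe_toNNReal M))).lipschitzOnWith
  -- Each local solution lives on an interval containing both t and t₀. By uniqueness the diagonal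
  -- coincides with `φ t` near t.
  refine ⟨fun t => φ t t, (h t₀ ht₀).2.2.2.1, fun t ht => ?_⟩
  obtain ⟨h1, h2, h3, h4, h5⟩ := h t ht
  refine (h5 t h1).congr_of_eventuallyEq ?_
  filter_upwards [Ioo_mem_nhds h1.1 h1.2, hI.mem_nhds ht] with s hs hsI
  exact hun t ht s hs hsI

theorem IsSolution.of_hasDerivAt {I : Set ℝ} (hI : IsOpen I) {κ u v : ℝ → ℝ}
    (hu : ∀ t ∈ I, HasDerivAt u (v t) t) (hv : ∀ t ∈ I, HasDerivAt v (-(κ t * u t)) t) :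
    IsSolution I κ u := fun t ht => by
  refine ⟨(hu t ht).differentiableAt, (hv t ht).congr_of_eventuallyEq ?_⟩
  filter_upwards [hI.mem_nhds ht] with s hs
  exact (hu s hs).deriv

/-- In polar coordinates u = r cos φ, u' = r sin φ the angle decouples, and r'/r = (1 - κ) sin φ cos
φ is integrated explicitly. Starting angles 0 and π/2 give the two fundamental solutions. -/
theorem exists_isSolution {I : Set ℝ} (hI : IsOpen I) (hI' : I.OrdConnected) {κ : ℝ → ℝ}
    (hκ : ContinuousOn κ I) {t₀ : ℝ} (ht₀ : t₀ ∈ I) (φ₀ : ℝ) :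
    ∃ u : ℝ → ℝ, IsSolution I κ u ∧ u t₀ = Real.cos φ₀ ∧ deriv u t₀ = Real.sin φ₀ := by
  obtain ⟨φ, h0, hφ⟩ := exists_prufer hI hI' hκ ht₀ φ₀
  have hφc : ContinuousOn φ I := fun t ht => (hφ t ht).continuousAt.continuousWithinAt
  have hg : ContinuousOn (fun t => (1 - κ t) * (Real.sin (φ t) * Real.cos (φ t))) I := by
    fun_prop
  have hr := fun t (ht : t ∈ I) =>
    (hasDerivAt_integral_of_continuousOn hI hI' hg ht₀ ht).exp
  set r : ℝ → ℝ := fun t =>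
    Real.exp (∫ τ in t₀..t, (1 - κ τ) * (Real.sin (φ τ) * Real.cos (φ τ))) with hr_def
  have hr0 : r t₀ = 1 := by simp [hr_def]
  have hu : ∀ t ∈ I, HasDerivAt (fun t => r t * Real.cos (φ t)) (r t * Real.sin (φ t)) t := by
    intro t ht
    have := (hr t ht).mul (hφ t ht).cos
    refine this.congr_deriv ?_
    change r t * _ * _ + r t * _ = _
    rw [pruferField]
    linear_combination (r t * Real.sin (φ t)) * Real.sin_sq_add_cos_sq (φ t)
  have hv : ∀ t ∈ I, HasDerivAt (fun t => r t * Real.sin (φ t))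
      (-(κ t * (r t * Real.cos (φ t)))) t := by
    intro t ht
    have := (hr t ht).mul (hφ t ht).sin
    refine this.congr_deriv ?_
    change r t * _ * _ + r t * _ = _
    rw [pruferField]
    linear_combination (-r t * κ t * Real.cos (φ t)) * Real.sin_sq_add_cos_sq (φ t)
  exact ⟨_, IsSolution.of_hasDerivAt hI hu hv, by simp [hr0, h0], by
    rw [(hu t₀ ht₀).deriv, hr0, h0, one_mul]⟩

theorem exists_isFundamentalPair {I : Set ℝ} (hI : IsOpen I) (hI' : I.OrdConnected) {κ : ℝ → ℝ}
    (hκ : ContinuousOn κ I) : ∃ c s : ℝ → ℝ → ℝ, IsFundamentalPair I κ c s := by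
  have h : ∀ φ₀ t₀ : ℝ, ∃ u : ℝ → ℝ, t₀ ∈ I →
      IsSolution I κ u ∧ u t₀ = Real.cos φ₀ ∧ deriv u t₀ = Real.sin φ₀ := by
    intro φ₀ t₀
    by_cases ht₀ : t₀ ∈ I
    · obtain ⟨u, hu⟩ := exists_isSolution hI hI' hκ ht₀ φ₀
      exact ⟨u, fun _ => hu⟩
    · exact ⟨0, fun h => absurd h ht₀⟩
  choose u hu using h
  refine ⟨fun t t₀ => u 0 t₀ t, fun t t₀ => u (Real.pi / 2) t₀ t, fun t₀ ht₀ => ⟨?_, ?_⟩⟩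
  · simpa using hu 0 t₀ ht₀
  · simpa using hu (Real.pi / 2) t₀ ht₀

/-! ### The Wronskian and the Ermakov–Pinney equation -/

/-- The derivatives are separate functions, so that explicit candidates can be inserted without
computing `deriv`. -/
theorem wronskian_eq {I : Set ℝ} (hI : IsOpen I) (hI' : I.OrdConnected) {κ u u' w w' : ℝ → ℝ}
    (hu : ∀ t ∈ I, HasDerivAt u (u' t) t) (hu' : ∀ t ∈ I, HasDerivAt u' (-(κ t * u t)) t)
    (hw : ∀ t ∈ I, HasDerivAt w (w' t) t) (hw' : ∀ t ∈ I, HasDerivAt w' (-(κ t * w t)) t)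
    {t t₀ : ℝ} (ht : t ∈ I) (ht₀ : t₀ ∈ I) :
    u t * w' t - w t * u' t = u t₀ * w' t₀ - w t₀ * u' t₀ := by
  have hd : ∀ τ ∈ I, HasDerivAt (fun τ => u τ * w' τ - w τ * u' τ) 0 τ := by
    intro τ hτ
    refine (((hu τ hτ).mul (hw' τ hτ)).sub ((hw τ hτ).mul (hu' τ hτ))).congr_deriv ?_
    ring
  exact hI.is_const_of_deriv_eq_zero hI'.isPreconnected
    (f := fun τ => u τ * w' τ - w τ * u' τ)
    (fun τ hτ => (hd τ hτ).differentiableAt.differentiableWithinAt)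
    (fun τ hτ => (hd τ hτ).deriv) ht ht₀

theorem IsSolution.hasDerivAt {I : Set ℝ} {κ u : ℝ → ℝ} (h : IsSolution I κ u) :
    ∀ t ∈ I, HasDerivAt u (deriv u t) t := fun t ht => (h t ht).1.hasDerivAt

theorem IsSolution.hasDerivAt_deriv {I : Set ℝ} {κ u : ℝ → ℝ} (h : IsSolution I κ u) :
    ∀ t ∈ I, HasDerivAt (deriv u) (-(κ t * u t)) t := fun t ht => (h t ht).2

/-- Pinney's formula: ρ = √(u² + w²) for two solutions with Wronskian 1. The Wronskian excludes
common zeros, and its square is the numerator of ρ⁻³. -/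
theorem exists_isEPSolution {I : Set ℝ} (hI : IsOpen I) (hI' : I.OrdConnected) {κ : ℝ → ℝ}
    (hκ : ContinuousOn κ I) : ∃ ρ : ℝ → ℝ, IsEPSolution I κ ρ := by
  rcases I.eq_empty_or_nonempty with rfl | ⟨t₀, ht₀⟩
  · exact ⟨0, fun t ht => absurd ht (Set.notMem_empty t)⟩
  obtain ⟨u, hu, hu0, hu0'⟩ := exists_isSolution hI hI' hκ ht₀ 0
  obtain ⟨w, hw, hw0, hw0'⟩ := exists_isSolution hI hI' hκ ht₀ (Real.pi / 2)
  have hW : ∀ t ∈ I, u t * deriv w t - w t * deriv u t = 1 := by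
    intro t ht
    rw [wronskian_eq hI hI' hu.hasDerivAt hu.hasDerivAt_deriv hw.hasDerivAt hw.hasDerivAt_deriv
      ht ht₀, hu0, hu0', hw0, hw0']
    simp
  have hpos : ∀ t ∈ I, 0 < u t ^ 2 + w t ^ 2 := by
    intro t ht
    by_contra hle
    have h1 : u t = 0 := by nlinarith [sq_nonneg (u t), sq_nonneg (w t)]
    have h2 : w t = 0 := by nlinarith [sq_nonneg (u t), sq_nonneg (w t)]
    have := hW t ht
    rw [h1, h2] at this
    simp at this
  set ρ : ℝ → ℝ := fun t => √(u t ^ 2 + w t ^ 2) with hρ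
  have hρp : ∀ t ∈ I, 0 < ρ t := fun t ht => Real.sqrt_pos.2 (hpos t ht)
  have hρ2 : ∀ t ∈ I, ρ t ^ 2 = u t ^ 2 + w t ^ 2 := fun t ht => Real.sq_sqrt (hpos t ht).le
  have hρd : ∀ t ∈ I, HasDerivAt ρ ((u t * deriv u t + w t * deriv w t) / ρ t) t := by
    intro t ht
    have := (((hu.hasDerivAt t ht).pow 2).add ((hw.hasDerivAt t ht).pow 2)).sqrt (hpos t ht).ne'
    refine this.congr_deriv ?_
    change _ / (2 * ρ t) = _
    have := (hρp t ht).ne'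
    field_simp
    push_cast
    ring
  refine ⟨ρ, fun t ht => ⟨hρp t ht, (hρd t ht).differentiableAt, ?_⟩⟩
  have h1 : HasDerivAt (fun t => (u t * deriv u t + w t * deriv w t) / ρ t)
      (1 / ρ t ^ 3 - κ t * ρ t) t := by
    refine ((((hu.hasDerivAt t ht).mul (hu.hasDerivAt_deriv t ht)).add
      ((hw.hasDerivAt t ht).mul (hw.hasDerivAt_deriv t ht))).div (hρd t ht)
      (hρp t ht).ne').congr_deriv ?_
    have h2 := (hρp t ht).ne'
    have h3 := hρ2 t ht
    have h4 := hW t ht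
    simp only [Pi.add_apply, Pi.mul_apply]
    generalize ρ t = r at *
    generalize deriv u t = u' at *
    generalize deriv w t = w' at *
    generalize u t = x at *
    generalize w t = y at *
    field_simp
    linear_combination (u' ^ 2 + w' ^ 2 - κ t * (x ^ 2 + y ^ 2) + κ t * r ^ 2 + κ t * (x ^ 2 + y ^ 2)) * h3
      + (x * w' - y * u' + 1) * h4
  refine h1.congr_of_eventuallyEq ?_
  filter_upwards [hI.mem_nhds ht] with τ hτ
  exact (hρd τ hτ).deriv

/-- The phase of an Ermakov–Pinney solution. -/
def epPhase (ρ : ℝ → ℝ) (t t₀ : ℝ) : ℝ := ∫ τ in t₀..t, 1 / ρ τ ^ 2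

section EP

variable {I : Set ℝ} {κ ρ : ℝ → ℝ}

theorem IsEPSolution.pos (h : IsEPSolution I κ ρ) : ∀ t ∈ I, 0 < ρ t := fun t ht => (h t ht).1

theorem IsEPSolution.hasDerivAt (h : IsEPSolution I κ ρ) :
    ∀ t ∈ I, HasDerivAt ρ (deriv ρ t) t := fun t ht => (h t ht).2.1.hasDerivAt

theorem IsEPSolution.hasDerivAt_deriv (h : IsEPSolution I κ ρ) :
    ∀ t ∈ I, HasDerivAt (deriv ρ) (1 / ρ t ^ 3 - κ t * ρ t) t := fun t ht => (h t ht).2.2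

theorem IsEPSolution.continuousOn_inv_sq (h : IsEPSolution I κ ρ) :
    ContinuousOn (fun τ => 1 / ρ τ ^ 2) I := by
  have hc : ContinuousOn ρ I := fun t ht =>
    (h.hasDerivAt t ht).continuousAt.continuousWithinAt
  exact continuousOn_const.div (hc.pow 2) fun t ht => (pow_pos (h.pos t ht) 2).ne'

theorem epPhase_self (ρ : ℝ → ℝ) (t : ℝ) : epPhase ρ t t = 0 := intervalIntegral.integral_same

theorem epPhase_symm (ρ : ℝ → ℝ) (t t₀ : ℝ) : epPhase ρ t₀ t = -epPhase ρ t t₀ :=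
  intervalIntegral.integral_symm _ _

theorem IsEPSolution.hasDerivAt_epPhase (hI : IsOpen I) (hI' : I.OrdConnected)
    (h : IsEPSolution I κ ρ) {t₀ t : ℝ} (ht₀ : t₀ ∈ I) (ht : t ∈ I) :
    HasDerivAt (fun t => epPhase ρ t t₀) (1 / ρ t ^ 2) t :=
  hasDerivAt_integral_of_continuousOn hI hI' h.continuousOn_inv_sq ht₀ ht

theorem IsEPSolution.continuousOn_epPhase (hI : IsOpen I) (hI' : I.OrdConnected)
    (h : IsEPSolution I κ ρ) {t₀ : ℝ} (ht₀ : t₀ ∈ I) :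
    ContinuousOn (fun t => epPhase ρ t t₀) I := fun _ ht =>
  (h.hasDerivAt_epPhase hI hI' ht₀ ht).continuousAt.continuousWithinAt

theorem IsEPSolution.strictMonoOn_epPhase (hI : IsOpen I) (hI' : I.OrdConnected)
    (h : IsEPSolution I κ ρ) {t₀ : ℝ} (ht₀ : t₀ ∈ I) :
    StrictMonoOn (fun t => epPhase ρ t t₀) I := by
  refine strictMonoOn_of_deriv_pos hI'.convex (h.continuousOn_epPhase hI hI' ht₀) fun t ht => ?_
  have ht' := interior_subset ht
  rw [(h.hasDerivAt_epPhase hI hI' ht₀ ht').deriv]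
  have := h.pos t ht'
  positivity

/-- The solutions of the oscillator equation in terms of a solution of the Ermakov–Pinney
equation. -/
theorem IsSolution.eq_of_isEPSolution (hI : IsOpen I) (hI' : I.OrdConnected)
    (h : IsEPSolution I κ ρ) {u : ℝ → ℝ} (hu : IsSolution I κ u) {t₀ t : ℝ} (ht₀ : t₀ ∈ I)
    (ht : t ∈ I) :
    u t = u t₀ / ρ t₀ * (ρ t * Real.cos (epPhase ρ t t₀)) +
      (ρ t₀ * deriv u t₀ - u t₀ * deriv ρ t₀) * (ρ t * Real.sin (epPhase ρ t t₀)) := by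
  set θ : ℝ → ℝ := fun t => epPhase ρ t t₀ with hθ
  have hθd : ∀ t ∈ I, HasDerivAt θ (1 / ρ t ^ 2) t := fun t ht =>
    h.hasDerivAt_epPhase hI hI' ht₀ ht
  have hB : ∀ t ∈ I, HasDerivAt (fun t => ρ t * Real.cos (θ t))
      (deriv ρ t * Real.cos (θ t) - Real.sin (θ t) / ρ t) t := by
    intro t ht
    refine ((h.hasDerivAt t ht).mul (hθd t ht).cos).congr_deriv ?_
    have := (h.pos t ht).ne'
    field_simp
    ring
  have hA : ∀ t ∈ I, HasDerivAt (fun t => ρ t * Real.sin (θ t))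
      (deriv ρ t * Real.sin (θ t) + Real.cos (θ t) / ρ t) t := by
    intro t ht
    refine ((h.hasDerivAt t ht).mul (hθd t ht).sin).congr_deriv ?_
    have := (h.pos t ht).ne'
    field_simp
  have hB' : ∀ t ∈ I, HasDerivAt (fun t => deriv ρ t * Real.cos (θ t) - Real.sin (θ t) / ρ t)
      (-(κ t * (ρ t * Real.cos (θ t)))) t := by
    intro t ht
    have hp := (h.pos t ht).ne'
    refine (((h.hasDerivAt_deriv t ht).mul (hθd t ht).cos).sub
      ((hθd t ht).sin.div (h.hasDerivAt t ht) hp)).congr_deriv ?_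
    field_simp
    ring
  have hA' : ∀ t ∈ I, HasDerivAt (fun t => deriv ρ t * Real.sin (θ t) + Real.cos (θ t) / ρ t)
      (-(κ t * (ρ t * Real.sin (θ t)))) t := by
    intro t ht
    have hp := (h.pos t ht).ne'
    refine (((h.hasDerivAt_deriv t ht).mul (hθd t ht).sin).add
      ((hθd t ht).cos.div (h.hasDerivAt t ht) hp)).congr_deriv ?_
    field_simp
    ring
  -- The functions ρ cos θ and ρ sin θ are solutions with Wronskian 1, so the two Wronskians with u
  -- are its coefficients. No separate uniqueness theorem is needed.
  have e1 := wronskian_eq hI hI' hu.hasDerivAt hu.hasDerivAt_deriv hA hA' ht ht₀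
  have e2 := wronskian_eq hI hI' hB hB' hu.hasDerivAt hu.hasDerivAt_deriv ht ht₀
  have hp := (h.pos t ht).ne'
  have hp0 := (h.pos t₀ ht₀).ne'
  have e3 : θ t₀ = 0 := epPhase_self ρ t₀
  simp only [e3, Real.sin_zero, Real.cos_zero, mul_zero, mul_one, zero_mul, sub_zero, zero_div,
    zero_add] at e1 e2
  have e4 := Real.sin_sq_add_cos_sq (θ t)
  change u t = u t₀ / ρ t₀ * (ρ t * Real.cos (θ t)) +
      (ρ t₀ * deriv u t₀ - u t₀ * deriv ρ t₀) * (ρ t * Real.sin (θ t))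
  have e5 : u t₀ / ρ t₀ = u t₀ * (1 / ρ t₀) := by ring
  rw [e5, ← e1, ← e2]
  field_simp
  linear_combination (-u t) * e4

/-! ### Counting zeros -/

/-- The zeros are y + kπ, and the interval open on the left and closed on the right is the one whose
integer points are counted by a difference of floors. -/
theorem ncard_sin_zeros {a b y : ℝ} (hab : a ≤ b) :
    ({x ∈ Set.Ioc a b | Real.sin (x - y) = 0}.ncard : ℤ) =
      ⌊(b - y) / Real.pi⌋ - ⌊(a - y) / Real.pi⌋ := by
  have hpi := Real.pi_pos
  have e : {x ∈ Set.Ioc a b | Real.sin (x - y) = 0} =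
      (fun k : ℤ => k * Real.pi + y) ''
        (Finset.Ioc ⌊(a - y) / Real.pi⌋ ⌊(b - y) / Real.pi⌋ : Set ℤ) := by
    ext x
    simp only [Set.mem_ofPred_eq, Set.mem_Ioc, Set.mem_image, Finset.coe_Ioc, Int.floor_lt,
      Int.le_floor, div_lt_iff₀ hpi, le_div_iff₀ hpi, Real.sin_eq_zero_iff]
    constructor
    · rintro ⟨⟨h1, h2⟩, k, hk⟩
      exact ⟨k, ⟨by linarith, by linarith⟩, by linarith⟩
    · rintro ⟨k, ⟨h1, h2⟩, rfl⟩
      exact ⟨⟨by linarith, by linarith⟩, k, by ring⟩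
  have hinj : Function.Injective (fun k : ℤ => k * Real.pi + y) := by
    intro k l hkl
    have : (k : ℝ) = l := mul_right_cancel₀ hpi.ne' (add_right_cancel hkl)
    exact_mod_cast this
  rw [e, Set.ncard_image_of_injective _ hinj, Set.ncard_coe_finset, Int.card_Ioc, Int.toNat_of_nonneg]
  have : ⌊(a - y) / Real.pi⌋ ≤ ⌊(b - y) / Real.pi⌋ := Int.floor_le_floor (by gcongr)
  omega

theorem ncard_zeros_eq (hI' : I.OrdConnected) {θ u : ℝ → ℝ} (hθ : StrictMonoOn θ I)
    (hθc : ContinuousOn θ I) {y : ℝ} (hu : ∀ τ ∈ I, u τ = 0 ↔ Real.sin (θ τ - y) = 0) {s t : ℝ}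
    (hs : s ∈ I) (ht : t ∈ I) (hst : s ≤ t) :
    ({τ ∈ Set.Ioc s t | u τ = 0}.ncard : ℤ) =
      ⌊(θ t - y) / Real.pi⌋ - ⌊(θ s - y) / Real.pi⌋ := by
  have hsub : Set.Icc s t ⊆ I := hI'.out hs ht
  rw [← ncard_sin_zeros (hθ.monotoneOn hs ht hst)]
  have e : {x ∈ Set.Ioc (θ s) (θ t) | Real.sin (x - y) = 0} =
      θ '' {τ ∈ Set.Ioc s t | u τ = 0} := by
    ext x
    constructor
    · rintro ⟨hx, hx0⟩
      obtain ⟨τ, hτ, rfl⟩ := intermediate_value_Icc hst (hθc.mono hsub) (Set.Ioc_subset_Icc_self hx)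
      refine ⟨τ, ⟨⟨lt_of_le_of_ne hτ.1 ?_, hτ.2⟩, (hu τ (hsub hτ)).2 hx0⟩, rfl⟩
      rintro rfl
      exact lt_irrefl _ hx.1
    · rintro ⟨τ, ⟨hτ, hτ0⟩, rfl⟩
      have hτI := hsub (Set.Ioc_subset_Icc_self hτ)
      exact ⟨⟨hθ hs hτI hτ.1, hθ.monotoneOn hτI ht hτ.2⟩, (hu τ hτI).1 hτ0⟩
  rw [e, Set.InjOn.ncard_image]
  exact hθ.injOn.mono fun τ hτ => hsub (Set.Ioc_subset_Icc_self hτ.1)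

/-- The increasing phase carries zeros of u bijectively to zeros of a shifted sine. The sign
convention for t < t₀ makes one floor formula serve both time orders. -/
theorem zeroIndex_eq (hI' : I.OrdConnected) {θ u : ℝ → ℝ} (hθ : StrictMonoOn θ I)
    (hθc : ContinuousOn θ I) {y : ℝ} (hu : ∀ τ ∈ I, u τ = 0 ↔ Real.sin (θ τ - y) = 0) {t₀ t : ℝ}
    (ht₀ : t₀ ∈ I) (ht : t ∈ I) :
    zeroIndex u t t₀ = ⌊(θ t - y) / Real.pi⌋ - ⌊(θ t₀ - y) / Real.pi⌋ := by
  rw [zeroIndex]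
  split_ifs with h
  · exact ncard_zeros_eq hI' hθ hθc hu ht₀ ht h
  · rw [ncard_zeros_eq hI' hθ hθc hu ht ht₀ (not_le.1 h).le]
    ring

end EP

/-! ### The exponentials -/

section Exponentials

theorem hasGen_chirp_two_mul (τ : ℝ) :
    HasGen (fun τ => chirp (2 * τ)) (fun ψ => Complex.I • (Q ∘L Q) ψ) τ :=
  ((hasGen_chirp (2 * τ)).comp ((hasDerivAt_id τ).const_mul 2)).congr fun ψ => by
    rw [smul_smul]
    congr 1
    push_cast
    ring

theorem hasGen_squeeze_two_mul (τ : ℝ) :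
    HasGen (fun τ => squeeze (2 * τ)) (fun ψ => Complex.I • (Q ∘L P + P ∘L Q) ψ) τ :=
  ((hasGen_squeeze (2 * τ)).comp ((hasDerivAt_id τ).const_mul 2)).congr fun ψ => by
    rw [smul_smul]
    congr 1
    push_cast
    ring

theorem hasGen_rot_neg_two_mul (τ : ℝ) :
    HasGen (fun τ => rot (-2 * τ)) (fun ψ => Complex.I • (P ∘L P + Q ∘L Q) ψ) τ :=
  ((hasGen_rot (-2 * τ)).comp ((hasDerivAt_id τ).const_mul (-2))).congr fun ψ => by
    rw [smul_smul]
    congr 1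
    push_cast
    ring

variable {H : Type*} [NormedAddCommGroup H] [InnerProductSpace ℂ H] (W : L2 ≃ₗᵢ[ℂ] H)

theorem D_eq_lift (x : ℝ) : D W x = lift W (chirp (-x)) := by
  rw [D, expI_eq_lift (V := fun τ => chirp (2 * τ)) isSymm_QQ (by simp only [mul_zero, chirp_zero])
    hasGen_chirp_two_mul]
  congr 2
  ring

theorem S_eq_lift (y : ℝ) : S W y = lift W (squeeze y) := by
  rw [S, expI_eq_lift (V := fun τ => squeeze (2 * τ)) isSymm_QP_add_PQ
    (by simp only [mul_zero, squeeze_zero]) hasGen_squeeze_two_mul]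
  congr 2
  ring

theorem R_eq_lift (ρ : ℝ → ℝ) (t t₀ : ℝ) : R W ρ t t₀ = lift W (rot (epPhase ρ t t₀)) := by
  rw [R, expI_eq_lift (V := fun τ => rot (-2 * τ)) isSymm_PP_add_QQ
    (by simp only [mul_zero, rot_zero]) hasGen_rot_neg_two_mul, epPhase]
  congr 2
  ring

/-- The inverse of `T_ρ(t)` on the Schwartz space. -/
def invT (ρ : ℝ → ℝ) (t : ℝ) : SchwartzUnitary :=
  chirp (deriv ρ t / ρ t) * squeeze (-Real.log (ρ t))

theorem invT_inv (ρ : ℝ → ℝ) (t : ℝ) :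
    (invT ρ t)⁻¹ = squeeze (Real.log (ρ t)) * chirp (-(deriv ρ t / ρ t)) := by
  have h1 : (chirp (deriv ρ t / ρ t))⁻¹ = chirp (-(deriv ρ t / ρ t)) :=
    inv_eq_of_mul_eq_one_right (by rw [← chirp_add, add_neg_cancel, chirp_zero])
  have h2 : (squeeze (-Real.log (ρ t)))⁻¹ = squeeze (Real.log (ρ t)) :=
    inv_eq_of_mul_eq_one_right (by rw [← squeeze_add, neg_add_cancel, squeeze_zero])
  rw [invT, mul_inv_rev, h1, h2]

theorem T_eq_lift (ρ : ℝ → ℝ) (t : ℝ) : T W ρ t = lift W (invT ρ t)⁻¹ := by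
  rw [T, S_eq_lift, D_eq_lift, ← lift_mul, invT_inv]

/-! ### The evolution -/

/-- The solution operator of the Schrödinger equation with value `T_ρ(t₀)⁻¹` at `t₀`. -/
def epEvolution (ρ : ℝ → ℝ) (t₀ t : ℝ) : SchwartzUnitary :=
  invT ρ t * rot (epPhase ρ t t₀)

theorem epEvolution_self (ρ : ℝ → ℝ) (t₀ : ℝ) : epEvolution ρ t₀ t₀ = invT ρ t₀ := by
  rw [epEvolution, epPhase_self, rot_zero, mul_one]

/-- The Hamiltonian on the Schwartz space. -/
abbrev schHamiltonian (k : ℝ) : Sch →L[ℂ] Sch :=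
  (1 / 2 : ℂ) • (P ∘L P + (k : ℂ) • (Q ∘L Q))

variable {I : Set ℝ} {κ ρ : ℝ → ℝ}

/-- With a = ρ'/ρ, b = -log ρ and α = β = ρ⁻², the Riccati condition reads κ = ρ⁻⁴ - ρ''/ρ, which is
the Ermakov–Pinney equation divided by ρ. -/
theorem hasGen_epEvolution (hI : IsOpen I) (hI' : I.OrdConnected) (h : IsEPSolution I κ ρ)
    {t₀ : ℝ} (ht₀ : t₀ ∈ I) : ∀ t ∈ I,
    HasGen (epEvolution ρ t₀) (fun ψ => (-Complex.I) • schHamiltonian (κ t) ψ) t := by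
  intro t ht
  have hρ := h.pos t ht
  have hd := h.hasDerivAt t ht
  have e1 : Real.exp (Real.log (ρ t)) = ρ t := Real.exp_log hρ
  have hB : HasGen (fun τ => rot (epPhase ρ τ t₀)) (fun ψ => (-(Complex.I / 2)) •
      (((1 / ρ t ^ 2 : ℝ) : ℂ) • P (P ψ) + ((1 / ρ t ^ 2 : ℝ) : ℂ) • Q (Q ψ))) t :=
    ((hasGen_rot _).comp (h.hasDerivAt_epPhase hI hI' ht₀ ht)).congr fun ψ => by
      rw [← smul_add, smul_comm]
  have := hasGen_chirp_mul_squeeze_mul (k := κ t) ((h.hasDerivAt_deriv t ht).div hd hρ.ne')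
    (hd.log hρ.ne').neg hB
    (by rw [Pi.neg_apply, neg_neg, e1]; field_simp) rfl
    (by rw [Pi.neg_apply, Pi.div_apply, Real.exp_neg, e1]; field_simp; ring)
  refine HasGen.congr_of_eventuallyEq this (Eventually.of_forall fun τ => ?_)
  simp only [epEvolution, invT, mul_assoc]
  rfl

theorem exists_isEvolution (hI : IsOpen I) (hI' : I.OrdConnected) (h : IsEPSolution I κ ρ) :
    ∃ U, IsEvolution W I κ U := by
  rcases I.eq_empty_or_nonempty with rfl | ⟨r, hr⟩
  · exact ⟨1, by simp, by simp, by simp, by simp⟩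
  have hg := hasGen_epEvolution hI hI' h hr
  refine ⟨fun t t₀ => lift W (epEvolution ρ r t * (epEvolution ρ r t₀)⁻¹), fun t _ => ?_,
    fun t₂ _ t₁ _ t₀ _ => ?_, fun φ => ?_, fun t₀ ht₀ t ht ψ => ?_⟩
  · rw [mul_inv_cancel, lift_one]
  · rw [← lift_mul]
    congr 1
    group
  · simp only [lift_mul, lift_inv]
    exact continuousOn_lift_mul_inv hg φ
  · refine ⟨embed W (schHamiltonian (κ t) ((epEvolution ρ r t * (epEvolution ρ r t₀)⁻¹) ψ)), ?_, ?_⟩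
    · rw [lift_embed]
      exact mem_graph_operator (A := schHamiltonian (κ t)) (isSymm_hamiltonian (κ t)) _
    · have h1 := ((hg t ht).mul_const (epEvolution ρ r t₀)⁻¹).embed (W := W) ψ
      rw [map_smul, neg_smul] at h1
      exact h1.congr_of_eventuallyEq (Eventually.of_forall fun τ => lift_embed W _ ψ)

variable {W}

/-- For each Schwartz state the orbit under U satisfies the hypotheses of `solution_eq`; only the
value 1 on the diagonal and the Schrödinger equation are used. -/
theorem IsEvolution.eq_lift (hI : IsOpen I) (hI' : I.OrdConnected) (h : IsEPSolution I κ ρ)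
    {U : ℝ → ℝ → H ≃ₗᵢ[ℂ] H} (hU : IsEvolution W I κ U) {t t₀ : ℝ} (ht : t ∈ I) (ht₀ : t₀ ∈ I) :
    U t t₀ = lift W (epEvolution ρ t₀ t * (invT ρ t₀)⁻¹) := by
  refine unitary_ext (W := W) fun ψ => ?_
  rw [solution_eq (W := W) hI hI' (z := -Complex.I) (by simp) (A := fun t => schHamiltonian (κ t))
    (fun t => isSymm_hamiltonian _) (hasGen_epEvolution hI hI' h ht₀)
    (u := fun τ => U τ t₀ (embed W ψ)) (fun τ hτ => ?_) ht ht₀]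
  · rw [hU.refl t₀ ht₀, epEvolution_self, ← lift_inv, lift_mul]
    rfl
  · obtain ⟨χ, h1, h2⟩ := hU.schrodinger t₀ ht₀ τ hτ ψ
    exact ⟨χ, h1, by rwa [neg_smul]⟩

end Exponentials

/-! ### The Maslov phases -/

theorem maslovPow_neg_half (u : ℝ → ℝ) (t t₀ : ℝ) :
    maslovPow u (-(1 / 2)) t t₀ = (-Complex.I) ^ zeroIndex u t t₀ * ((√|u t|)⁻¹ : ℝ) := by
  rw [maslovPow, Real.rpow_neg (abs_nonneg _), ← Real.sqrt_eq_rpow]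
  congr 1
  have : Complex.exp (-(Real.pi / 2 * Complex.I)) = -Complex.I := by
    rw [Complex.exp_neg, Complex.exp_pi_div_two_mul_I, Complex.inv_I]
  rw [← this, ← Complex.exp_int_mul]
  congr 1
  push_cast
  ring

theorem two_pi_I_cpow_neg_half : (2 * Real.pi * Complex.I) ^ (-(1 / 2) : ℂ) =
    Complex.exp (-(Real.pi / 4 * Complex.I)) * ((√(2 * Real.pi))⁻¹ : ℝ) := by
  have h : (0 : ℝ) < 2 * Real.pi := by positivity
  have e : (2 * Real.pi * Complex.I : ℂ) = ((2 * Real.pi : ℝ) : ℂ) * Complex.I := by push_cast; rfl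
  rw [e, Complex.cpow_def_of_ne_zero
    (mul_ne_zero (Complex.ofReal_ne_zero.2 h.ne') Complex.I_ne_zero),
    Complex.log_ofReal_mul h Complex.I_ne_zero, Complex.log_I, ← exp_neg_log_div_two h,
    Complex.ofReal_exp, ← Complex.exp_add]
  congr 1
  push_cast
  ring

/-- The fundamental solutions in terms of the amplitude and the phase of an Ermakov–Pinney
solution. -/
theorem IsFundamentalPair.sin_eq {I : Set ℝ} {κ ρ : ℝ → ℝ} {c s : ℝ → ℝ → ℝ} (hI : IsOpen I)
    (hI' : I.OrdConnected) (h : IsEPSolution I κ ρ) (hcs : IsFundamentalPair I κ c s) {t t₀ : ℝ}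
    (ht : t ∈ I) (ht₀ : t₀ ∈ I) : s t t₀ = ρ t * ρ t₀ * Real.sin (epPhase ρ t t₀) := by
  obtain ⟨hs, h0, h1⟩ := (hcs t₀ ht₀).2
  have := hs.eq_of_isEPSolution hI hI' h ht₀ ht
  rw [h0, h1] at this
  rw [this]
  ring

theorem IsFundamentalPair.cos_eq {I : Set ℝ} {κ ρ : ℝ → ℝ} {c s : ℝ → ℝ → ℝ} (hI : IsOpen I)
    (hI' : I.OrdConnected) (h : IsEPSolution I κ ρ) (hcs : IsFundamentalPair I κ c s) {t t₀ : ℝ}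
    (ht : t ∈ I) (ht₀ : t₀ ∈ I) : c t t₀ =
      ρ t * (Real.cos (epPhase ρ t t₀) / ρ t₀ - deriv ρ t₀ * Real.sin (epPhase ρ t t₀)) := by
  obtain ⟨hc, h0, h1⟩ := (hcs t₀ ht₀).1
  have := hc.eq_of_isEPSolution hI hI' h ht₀ ht
  rw [h0, h1] at this
  rw [this]
  ring

/-! ### Zero indices, kernels and caustics. -/

section Kernel

variable {I : Set ℝ} {κ ρ : ℝ → ℝ} {c s : ℝ → ℝ → ℝ} {t t₀ : ℝ}

theorem IsFundamentalPair.zeroIndex_sin (hI : IsOpen I)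
    (hI' : I.OrdConnected) (h : IsEPSolution I κ ρ) (hcs : IsFundamentalPair I κ c s)
    (ht : t ∈ I) (ht₀ : t₀ ∈ I) :
    zeroIndex (fun τ => s τ t₀) t t₀ = ⌊epPhase ρ t t₀ / Real.pi⌋ := by
  rw [zeroIndex_eq hI' (h.strictMonoOn_epPhase hI hI' ht₀) (h.continuousOn_epPhase hI hI' ht₀)
    (y := 0) (fun τ hτ => ?_) ht₀ ht, epPhase_self]
  · simp
  · rw [hcs.sin_eq hI hI' h hτ ht₀, sub_zero]
    have := h.pos τ hτ
    have := h.pos t₀ ht₀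
    simp [*, ne_of_gt]

/-- Up to a positive factor c is cos θ - a sin θ, a shifted sine. Over a phase difference of exactly
jπ the floor difference is j, whatever the shift. -/
theorem IsFundamentalPair.zeroIndex_cos (hI : IsOpen I)
    (hI' : I.OrdConnected) (h : IsEPSolution I κ ρ) (hcs : IsFundamentalPair I κ c s)
    (ht : t ∈ I) (ht₀ : t₀ ∈ I) {j : ℤ} (hj : j * Real.pi = epPhase ρ t t₀) :
    zeroIndex (fun τ => c τ t₀) t t₀ = j := by
  have hpi := Real.pi_pos
  have hr := h.pos t₀ ht₀
  set a := ρ t₀ * deriv ρ t₀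
  rw [zeroIndex_eq hI' (h.strictMonoOn_epPhase hI hI' ht₀) (h.continuousOn_epPhase hI hI' ht₀)
    (y := Real.pi / 2 - Real.arctan a) (fun τ hτ => ?_) ht₀ ht, epPhase_self, ← hj]
  · have e : (j * Real.pi - (Real.pi / 2 - Real.arctan a)) / Real.pi =
        (0 - (Real.pi / 2 - Real.arctan a)) / Real.pi + j := by field_simp; ring
    rw [e, Int.floor_add_intCast]
    ring
  · have hrτ := h.pos τ hτ
    have e : Real.sin (epPhase ρ τ t₀ - (Real.pi / 2 - Real.arctan a)) =
        -(Real.cos (Real.arctan a)) *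
          (Real.cos (epPhase ρ τ t₀) - a * Real.sin (epPhase ρ τ t₀)) := by
      rw [sub_sub_eq_add_sub, sub_eq_add_neg, ← sub_eq_add_neg, Real.sin_sub_pi_div_two, Real.cos_add]
      have : Real.sin (Real.arctan a) = a * Real.cos (Real.arctan a) := by
        rw [← Real.tan_mul_cos (Real.cos_arctan_pos a).ne', Real.tan_arctan]
      rw [this]
      ring
    have e2 : c τ t₀ = ρ τ / ρ t₀ *
        (Real.cos (epPhase ρ τ t₀) - a * Real.sin (epPhase ρ τ t₀)) := by
      rw [hcs.cos_eq hI hI' h hτ ht₀]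
      field_simp
      ring
    rw [e, e2, mul_eq_zero, mul_eq_zero]
    have := Real.cos_arctan_pos a
    simp [this.ne', hrτ.ne', hr.ne']

theorem IsFundamentalPair.deriv_cos (hI : IsOpen I)
    (hI' : I.OrdConnected) (h : IsEPSolution I κ ρ) (hcs : IsFundamentalPair I κ c s)
    (ht : t ∈ I) (ht₀ : t₀ ∈ I) (hs : Real.sin (epPhase ρ t t₀) = 0) :
    deriv (fun τ => c τ t₀) t =
      Real.cos (epPhase ρ t t₀) * (deriv ρ t / ρ t₀ - deriv ρ t₀ / ρ t) := by
  have hθ := h.hasDerivAt_epPhase hI hI' ht₀ ht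
  have hd := (h.hasDerivAt t ht).mul ((hθ.cos.div_const (ρ t₀)).sub (hθ.sin.const_mul (deriv ρ t₀)))
  have hr := h.pos t ht
  refine (hd.congr_of_eventuallyEq ?_).deriv.trans ?_
  · filter_upwards [hI.mem_nhds ht] with τ hτ
    exact hcs.cos_eq hI hI' h hτ ht₀
  · simp only [Pi.sub_apply, hs]
    field_simp
    ring

/-! ### The kernel of the evolution -/

theorem exp_log_div_two {r : ℝ} (hr : 0 < r) : Real.exp (Real.log r / 2) = √r := by
  rw [← inv_inj, ← Real.exp_neg, ← neg_div, exp_neg_log_div_two hr]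

theorem invT_apply (h : 0 < ρ t) (ψ : Sch) (q : ℝ) :
    invT ρ t ψ q = chirpFun (deriv ρ t / ρ t) q * ((√(ρ t))⁻¹ : ℝ) * ψ (q / ρ t) := by
  rw [invT, SchwartzUnitary.mul_apply, chirp_apply, squeeze_apply, exp_neg_log_div_two h,
    Real.exp_neg, Real.exp_log h, ← div_eq_mul_inv, mul_assoc]

theorem invT_inv_apply (h : 0 < ρ t) (ψ : Sch) (x : ℝ) :
    (invT ρ t)⁻¹ ψ x = (√(ρ t) : ℝ) * (chirpFun (-(deriv ρ t / ρ t)) (x * ρ t) * ψ (x * ρ t)) := by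
  rw [invT_inv, SchwartzUnitary.mul_apply, squeeze_apply, chirp_apply, exp_log_div_two h,
    Real.exp_log h]

theorem propagator_eq (q q₀ : ℝ) :
    propagator c s q t q₀ t₀ = Complex.exp (-(Real.pi / 4 * Complex.I)) *
      (-Complex.I) ^ zeroIndex (fun τ => s τ t₀) t t₀ * ((√(2 * Real.pi * |s t t₀|))⁻¹ : ℝ) *
      Complex.exp ((((c t₀ t * q ^ 2 + c t t₀ * q₀ ^ 2 - 2 * q * q₀) / (2 * s t t₀) : ℝ) : ℂ) *
        Complex.I) := by
  rw [propagator, maslovPow_neg_half, two_pi_I_cpow_neg_half,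
    Real.sqrt_mul (by positivity : (0 : ℝ) ≤ 2 * Real.pi), mul_inv]
  have : Complex.I / (2 * s t t₀) * (c t₀ t * q ^ 2 + c t t₀ * q₀ ^ 2 - 2 * q * q₀) =
      (((c t₀ t * q ^ 2 + c t t₀ * q₀ ^ 2 - 2 * q * q₀) / (2 * s t t₀) : ℝ) : ℂ) * Complex.I := by
    push_cast
    ring
  rw [this]
  push_cast
  ring

theorem integrable_propagator_mul (c s : ℝ → ℝ → ℝ) (q t t₀ : ℝ) (ψ : Sch) :
    Integrable (fun q₀ : ℝ => propagator c s q t q₀ t₀ * ψ q₀) := by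
  simp only [propagator_eq]
  refine ψ.integrable.bdd_mul (c := ‖Complex.exp (-(Real.pi / 4 * Complex.I)) *
    (-Complex.I) ^ zeroIndex (fun τ => s τ t₀) t t₀ * ((√(2 * Real.pi * |s t t₀|))⁻¹ : ℝ)‖)
    (Continuous.aestronglyMeasurable (by fun_prop)) (Eventually.of_forall fun q₀ => ?_)
  rw [norm_mul, Complex.norm_exp_ofReal_mul_I, mul_one]

/-- The substitution q₀ = vρ(t₀) undoes the initial dilation. The two chirps complete the Mehler
exponent to the quadratic form in c, and the scale factors combine with |sin θ| to |s|. -/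
theorem epEvolution_apply_eq_integral (hI : IsOpen I) (hI' : I.OrdConnected)
    (h : IsEPSolution I κ ρ) (hcs : IsFundamentalPair I κ c s) (ht : t ∈ I) (ht₀ : t₀ ∈ I)
    (hs : s t t₀ ≠ 0) (ψ : Sch) (q : ℝ) :
    (epEvolution ρ t₀ t * (invT ρ t₀)⁻¹) ψ q = ∫ q₀ : ℝ, propagator c s q t q₀ t₀ * ψ q₀ := by
  have hr := h.pos t ht
  have hr₀ := h.pos t₀ ht₀
  have e1 := hcs.sin_eq hI hI' h ht ht₀
  have hsin : Real.sin (epPhase ρ t t₀) ≠ 0 := right_ne_zero_of_mul (e1 ▸ hs)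
  have e2 := hcs.cos_eq hI hI' h ht ht₀
  have e3 := hcs.cos_eq hI hI' h ht₀ ht
  -- For c(t₀, t) the base point is t, so the phase enters with the opposite sign.
  rw [epPhase_symm, Real.cos_neg, Real.sin_neg] at e3
  have hprop : ∀ q₀, propagator c s q t q₀ t₀ * ψ q₀ =
      Complex.exp (-(Real.pi / 4 * Complex.I)) * (-Complex.I) ^ ⌊epPhase ρ t t₀ / Real.pi⌋ *
      ((√(2 * Real.pi * |s t t₀|))⁻¹ : ℝ) *
      (Complex.exp ((((c t₀ t * q ^ 2 + c t t₀ * q₀ ^ 2 - 2 * q * q₀) /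
        (2 * s t t₀) : ℝ) : ℂ) * Complex.I) * ψ q₀) := fun q₀ => by
    rw [propagator_eq, hcs.zeroIndex_sin hI hI' h ht ht₀, mul_assoc]
  simp only [hprop]
  rw [integral_const_mul, epEvolution, SchwartzUnitary.mul_apply,
    SchwartzUnitary.mul_apply, invT_apply hr, rot_apply hsin]
  simp only [invT_inv_apply hr₀]
  set θ := epPhase ρ t t₀
  set g : ℝ → ℂ := fun w => Complex.exp ((((c t₀ t * q ^ 2 + c t t₀ * w ^ 2 - 2 * q * w) /
    (2 * s t t₀) : ℝ) : ℂ) * Complex.I) * ψ w with hg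
  have hint : chirpFun (deriv ρ t / ρ t) q *
      ∫ v : ℝ, mehlerFun (Real.cos θ) (Real.sin θ) (q / ρ t) v * ((√(ρ t₀) : ℝ) *
        (chirpFun (-(deriv ρ t₀ / ρ t₀)) (v * ρ t₀) * ψ (v * ρ t₀))) =
      ((√(ρ t₀))⁻¹ : ℝ) * ∫ w, g w := by
    have h1 : ∀ v : ℝ, chirpFun (deriv ρ t / ρ t) q *
        (mehlerFun (Real.cos θ) (Real.sin θ) (q / ρ t) v * ((√(ρ t₀) : ℝ) *
        (chirpFun (-(deriv ρ t₀ / ρ t₀)) (v * ρ t₀) * ψ (v * ρ t₀)))) =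
        (√(ρ t₀) : ℝ) * g (v * ρ t₀) := by
      intro v
      have h2 : chirpFun (deriv ρ t / ρ t) q * mehlerFun (Real.cos θ) (Real.sin θ) (q / ρ t) v *
          chirpFun (-(deriv ρ t₀ / ρ t₀)) (v * ρ t₀) =
          Complex.exp ((((c t₀ t * q ^ 2 + c t t₀ * (v * ρ t₀) ^ 2 - 2 * q * (v * ρ t₀)) /
            (2 * s t t₀) : ℝ) : ℂ) * Complex.I) := by
        rw [chirpFun, chirpFun, mehlerFun, ← Complex.exp_add, ← Complex.exp_add,
          mul_comm Complex.I, mul_comm Complex.I, ← add_mul, ← add_mul, ← Complex.ofReal_add,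
          ← Complex.ofReal_add, e1, e2, e3]
        congr 3
        field_simp
        ring
      rw [hg]
      simp only
      rw [← h2]
      ring
    rw [← integral_const_mul]
    simp only [h1]
    rw [integral_const_mul, Measure.integral_comp_mul_right, abs_of_pos (inv_pos.2 hr₀),
      Complex.real_smul, ← mul_assoc, ← Complex.ofReal_mul]
    congr 2
    rw [← div_eq_mul_inv, Real.sqrt_div_self]
  have hsq : (√(2 * Real.pi * |s t t₀|))⁻¹ =
      (√(2 * Real.pi * |Real.sin θ|))⁻¹ * ((√(ρ t))⁻¹ * (√(ρ t₀))⁻¹) := by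
    rw [← mul_inv, ← mul_inv, ← Real.sqrt_mul hr.le, ← Real.sqrt_mul (by positivity), e1, abs_mul,
      abs_of_pos (mul_pos hr hr₀)]
    congr 2
    ring
  rw [hsq]
  push_cast at hint ⊢
  linear_combination ((√(ρ t))⁻¹ : ℂ) * Complex.exp (-(Real.pi / 4 * Complex.I)) *
    (-Complex.I) ^ ⌊θ / Real.pi⌋ * (√(2 * Real.pi * |Real.sin θ|) : ℂ)⁻¹ * hint

/-- At s = 0 the phase is jπ and the rotation is (-i)^j times the j-th power of parity. The operator
only rescales, reflects and multiplies by phases, and c = (-1)^j ρ(t)/ρ(t₀) encodes the scale and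
the reflection. -/
theorem epEvolution_apply_eq_causticPropagator (hI : IsOpen I) (hI' : I.OrdConnected)
    (h : IsEPSolution I κ ρ) (hcs : IsFundamentalPair I κ c s) (ht : t ∈ I) (ht₀ : t₀ ∈ I)
    (hs : s t t₀ = 0) (ψ : Sch) (q : ℝ) :
    (epEvolution ρ t₀ t * (invT ρ t₀)⁻¹) ψ q = causticPropagator c q t t₀ ψ := by
  have hr := h.pos t ht
  have hr₀ := h.pos t₀ ht₀
  have e1 := hcs.sin_eq hI hI' h ht ht₀
  have hsin : Real.sin (epPhase ρ t t₀) = 0 := by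
    rw [hs, eq_comm, mul_eq_zero] at e1
    exact e1.resolve_left (mul_pos hr hr₀).ne'
  obtain ⟨j, hj⟩ := Real.sin_eq_zero_iff.1 hsin
  have e2 := hcs.cos_eq hI hI' h ht ht₀
  have e3 := hcs.deriv_cos hI hI' h ht ht₀ hsin
  rw [hsin, mul_zero, sub_zero, ← hj, Real.cos_int_mul_pi] at e2
  rw [← hj, Real.cos_int_mul_pi] at e3
  have hone : ((-1 : ℝ) ^ j) * (-1) ^ j = 1 := by
    rw [← mul_zpow]; norm_num
  have hne : ((-1 : ℝ) ^ j) ≠ 0 := zpow_ne_zero _ (by norm_num)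
  have hq : q / c t t₀ = (-1) ^ j * (q / ρ t) * ρ t₀ := by
    rw [e2]
    field_simp
    linear_combination -q * hone
  have habs : (√|c t t₀|)⁻¹ = (√(ρ t))⁻¹ * √(ρ t₀) := by
    rw [e2, abs_mul, abs_div, abs_zpow, abs_neg, abs_one, one_zpow, abs_of_pos hr, abs_of_pos hr₀,
      mul_one_div, Real.sqrt_div hr.le, inv_div, mul_comm, div_eq_mul_inv, mul_comm]
  have hexp : Complex.exp (Complex.I * deriv (fun τ => c τ t₀) t / (2 * c t t₀) * q ^ 2) =
      chirpFun (deriv ρ t / ρ t) q *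
        chirpFun (-(deriv ρ t₀ / ρ t₀)) ((-1) ^ j * (q / ρ t) * ρ t₀) := by
    rw [chirpFun, chirpFun, ← Complex.exp_add, ← mul_add, ← Complex.ofReal_add, e3, e2]
    have : deriv ρ t / ρ t / 2 * q ^ 2 + -(deriv ρ t₀ / ρ t₀) / 2 *
        ((-1) ^ j * (q / ρ t) * ρ t₀) ^ 2 = ((-1) ^ j *
          (deriv ρ t / ρ t₀ - deriv ρ t₀ / ρ t)) / (2 * (ρ t * ((-1) ^ j / ρ t₀))) * q ^ 2 := by
      rw [mul_pow, mul_pow, pow_two ((-1 : ℝ) ^ j), hone]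
      field_simp
      ring
    rw [this]
    congr 1
    push_cast
    ring
  change _ = (maslovPow (fun τ => c τ t₀) (-(1 / 2)) t t₀ * _) * ψ (q / c t t₀)
  rw [maslovPow_neg_half, hcs.zeroIndex_cos hI hI' h ht ht₀ hj, hexp, hq, habs, epEvolution,
    SchwartzUnitary.mul_apply, SchwartzUnitary.mul_apply, invT_apply hr, ← hj,
    rot_int_mul_pi_apply, invT_inv_apply hr₀]
  push_cast
  ring

end Kernel

end TDHO

end

theorem theoremD2 (I : Set ℝ) (hI : IsOpen I) (hI' : I.OrdConnected)
    (κ : ℝ → ℝ) (hκ : ContinuousOn κ I)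
    {H : Type*} [NormedAddCommGroup H] [InnerProductSpace ℂ H] (W : TDHO.L2 ≃ₗᵢ[ℂ] H) :
    -- the classical solutions and the exponentials exist
    (∃ c s : ℝ → ℝ → ℝ, TDHO.IsFundamentalPair I κ c s) ∧
    (∃ ρ : ℝ → ℝ, TDHO.IsEPSolution I κ ρ) ∧
    (∃! V, TDHO.IsUnitaryGroupOf (TDHO.operator W (TDHO.Q ∘L TDHO.Q)) V) ∧
    (∃! V, TDHO.IsUnitaryGroupOf
      (TDHO.operator W (TDHO.Q ∘L TDHO.P + TDHO.P ∘L TDHO.Q)) V) ∧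
    (∃! V, TDHO.IsUnitaryGroupOf
      (TDHO.operator W (TDHO.P ∘L TDHO.P + TDHO.Q ∘L TDHO.Q)) V) ∧
    -- the evolution exists, and every evolution is given by the two formulas
    (∃ U, TDHO.IsEvolution W I κ U) ∧
    ∀ U, TDHO.IsEvolution W I κ U →
      (∀ ρ : ℝ → ℝ, TDHO.IsEPSolution I κ ρ → ∀ t ∈ I, ∀ t₀ ∈ I,
        U t t₀ = (TDHO.T W ρ t)⁻¹ * TDHO.R W ρ t t₀ * TDHO.T W ρ t₀) ∧
      (∀ c s : ℝ → ℝ → ℝ, TDHO.IsFundamentalPair I κ c s → ∀ t ∈ I, ∀ t₀ ∈ I,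
        ∀ ψ : 𝓢(ℝ, ℂ),
        (s t t₀ ≠ 0 →
          (∀ q : ℝ, MeasureTheory.Integrable
            (fun q₀ : ℝ => TDHO.propagator c s q t q₀ t₀ * ψ q₀)) ∧
          (W.symm (U t t₀ (TDHO.embed W ψ)) : ℝ → ℂ) =ᵐ[MeasureTheory.volume]
            fun q : ℝ => ∫ q₀ : ℝ, TDHO.propagator c s q t q₀ t₀ * ψ q₀) ∧
        (s t t₀ = 0 →
          (W.symm (U t t₀ (TDHO.embed W ψ)) : ℝ → ℂ) =ᵐ[MeasureTheory.volume]
            fun q : ℝ => TDHO.causticPropagator c q t t₀ ψ)) := by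
  -- One auxiliary ρ serves for the existence of the evolution and for the kernels, which do not
  -- depend on it; the factorization is proved for every ρ.
  obtain ⟨ρ, hρ⟩ := TDHO.exists_isEPSolution hI hI' hκ
  refine ⟨TDHO.exists_isFundamentalPair hI hI' hκ, ⟨ρ, hρ⟩,
    TDHO.existsUnique_isUnitaryGroupOf TDHO.isSymm_QQ
      (V := fun τ => TDHO.chirp (2 * τ)) (by simp only [mul_zero, TDHO.chirp_zero])
      TDHO.hasGen_chirp_two_mul,
    TDHO.existsUnique_isUnitaryGroupOf TDHO.isSymm_QP_add_PQ
      (V := fun τ => TDHO.squeeze (2 * τ)) (by simp only [mul_zero, TDHO.squeeze_zero])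
      TDHO.hasGen_squeeze_two_mul,
    TDHO.existsUnique_isUnitaryGroupOf TDHO.isSymm_PP_add_QQ
      (V := fun τ => TDHO.rot (-2 * τ)) (by simp only [mul_zero, TDHO.rot_zero])
      TDHO.hasGen_rot_neg_two_mul,
    TDHO.exists_isEvolution W hI hI' hρ, fun U hU => ⟨fun ρ hρ t ht t₀ ht₀ => ?_,
      fun c s hcs t ht t₀ ht₀ ψ => ?_⟩⟩
  · rw [hU.eq_lift hI hI' hρ ht ht₀, TDHO.T_eq_lift, TDHO.T_eq_lift, TDHO.R_eq_lift,
      ← TDHO.lift_inv, inv_inv, ← TDHO.lift_mul, ← TDHO.lift_mul, TDHO.epEvolution]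
  -- The almost-everywhere equality only reflects the choice of an L² representative: for the
  -- Schwartz representative both kernel formulas hold at every q.
  · have hae : (W.symm (U t t₀ (TDHO.embed W ψ)) : ℝ → ℂ) =ᵐ[MeasureTheory.volume]
        (TDHO.epEvolution ρ t₀ t * (TDHO.invT ρ t₀)⁻¹) ψ := by
      rw [hU.eq_lift hI hI' hρ ht ht₀, TDHO.lift_embed, TDHO.embed_apply, W.symm_apply_apply]
      exact SchwartzMap.coeFn_toLp _ _ _
    refine ⟨fun hs => ⟨fun q => TDHO.integrable_propagator_mul c s q t t₀ ψ, ?_⟩, fun hs => ?_⟩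
    · exact hae.trans (Filter.Eventually.of_forall fun q =>
        TDHO.epEvolution_apply_eq_integral hI hI' hρ hcs ht ht₀ hs ψ q)
    · exact hae.trans (Filter.Eventually.of_forall fun q =>
        TDHO.epEvolution_apply_eq_causticPropagator hI hI' hρ hcs ht ht₀ hs ψ q)
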